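/- Let $K$ be a field, $G$ a finite abelian group (written multiplicatively) and $A=KG$ its group algebra. For $n\ge 0$ let $C^n(A)=\mathrm{Hom}_K(A^{\otimes n},A)$ be the Hochschild cochains with the Hochschild differential $\delta$, and $HH^n(A)$ their cohomology. For $f\in C^n(A)$, $g\in C^m(A)$ put $$(f\circ_i g)(x_1\otimes\cdots\otimes x_{n+m-1})=f(x_1\otimes\cdots\otimes g(x_i\otimes\cdots\otimes x_{i+m-1})\otimes\cdots\otimes x_{n+m-1}),\qquad 1\le i\le n,$$ $$f\circ g=\sum_{i=1}^{n}(-1)^{(i-1)(m-1)}f\circ_i g,\qquad [f,g]_G=f\circ g-(-1)^{(n-1)(m-1)}g\circ f .$$ The Gerstenhaber bracket on $HH^{*+1}(A)$ is the bilinear bracket induced by $[-,-]_G$ on cocycles; here $HH^n(A)$ is placed in degree $n-1$. Let $H^n(G,K)$ be the group cohomology of $G$ with coefficients in the trivial module $K$, computed by inhomogeneous cochains $\mathrm{Map}(G^{\times n},K)$. For $\alpha\in\mathrm{Map}(G^{\times n},K)$, $\beta\in\mathrm{Map}(G^{\times m},K)$ and $y\in G$ let $$\gamma_\alpha^{(\beta,y)}(x_1|\cdots|x_{n+m-1})=\sum_{i=1}^{n}(-1)^{(m-1)(i-1)}\,\alpha(x_1|\cdots|x_{i-1}|x_ix_{i+1}\cdots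 x_{i+m-1}\,y\,|x_{i+m}|\cdots|x_{n+m-1})\;\beta(x_i|\cdots|x_{i+m-1}),$$ and consider the bilinear map $\mathrm{Map}(G^{\times n},K)\otimes A\times \mathrm{Map}(G^{\times m},K)\otimes A\to \mathrm{Map}(G^{\times n+m-1},K)\otimes A$ given for $x,y\in G$ by $$[\alpha\otimes x,\beta\otimes y]=\bigl(\gamma_\alpha^{(\beta,y)}-(-1)^{(n-1)(m-1)}\gamma_\beta^{(\alpha,x)}\bigr)\otimes xy$$ (it is zero for $n=m=0$). Then: 1. This bracket is well defined on $H^{*+1}(G,K)\otimes A$: if $\alpha$ and $\beta$ are cocycles then $\gamma_\alpha^{(\beta,y)}-(-1)^{(n-1)(m-1)}\gamma_\beta^{(\alpha,x)}$ is a cocycle, and there is a unique bilinear bracket on $\bigoplus_{n\ge0}H^n(G,K)\otimes A$ whose value on the pair $([\alpha]\otimes x,[\beta]\otimes y)$ is the class of that cocycle tensored with $xy$. 2. With this bracket, and with $H^n(G,K)\otimes A$ placed in degree $n-1$, $H^{*+1}(G,K)\otimes A$ is a graded Lie algebra. 3. The Gerstenhaber bracket is likewise well defined on $HH^{*+1}(A)$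 and makes it a graded Lie algebra, and $HH^{*+1}(A)$ with the Gerstenhaber bracket is isomorphic, as a graded Lie algebra, to $H^{*+1}(G,K)\otimes A$ with the bracket above. Here a graded Lie algebra is a $\mathbb Z$-graded $K$-vector space with a bilinear bracket of degree $0$ such that, for homogeneous $a,b,c$, $[a,b]=-(-1)^{|a||b|}[b,a]$ and $[a,[b,c]]=[[a,b],c]+(-1)^{|a||b|}[b,[a,c]]$, and moreover $[a,a]=0$ for $|a|$ even and $[a,[a,a]]=0$ for $|a|$ odd (conditions that matter only in characteristics $2$ and $3$). -/

import Mathlib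

open scoped DirectSum TensorProduct

universe u

set_option maxSynthPendingDepth 3

/-! ### Graded Lie algebras -/

/-- `(L, B)` is a graded Lie algebra (with the usual signs) for the grading `𝓛` of `L`:
the bracket has degree zero, is graded antisymmetric and satisfies the graded Jacobi identity.
The fields `bracket_self` and `bracket_bracket_self` follow from the others when `2`,
respectively `3`, is invertible; they are the usual extra axioms over arbitrary fields. -/
structure IsGradedLieAlgebra {K L : Type*} [Field K] [AddCommGroup L] [Module K L]
    (𝓛 : ℤ → Submodule K L) (B : L →ₗ[K] L →ₗ[K] L) : Prop where
  isInternal : DirectSum.IsInternal 𝓛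
  bracket_mem : ∀ {i j : ℤ} {x y : L}, x ∈ 𝓛 i → y ∈ 𝓛 j → B x y ∈ 𝓛 (i + j)
  antisymm : ∀ {i j : ℤ} {x y : L}, x ∈ 𝓛 i → y ∈ 𝓛 j →
    B x y = -((i * j).negOnePow • B y x)
  jacobi : ∀ {i j k : ℤ} {x y z : L}, x ∈ 𝓛 i → y ∈ 𝓛 j → z ∈ 𝓛 k →
    B x (B y z) = B (B x y) z + (i * j).negOnePow • B y (B x z)
  bracket_self : ∀ {i : ℤ} {x : L}, Even i → x ∈ 𝓛 i → B x x = 0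
  bracket_bracket_self : ∀ {i : ℤ} {x : L}, Odd i → x ∈ 𝓛 i → B x (B x x) = 0

/-- `e` is an isomorphism of graded Lie algebras: a linear isomorphism that preserves degrees
and brackets. -/
structure IsGradedLieIso {K L L' : Type*} [Field K] [AddCommGroup L] [Module K L]
    [AddCommGroup L'] [Module K L']
    (𝓛 : ℤ → Submodule K L) (B : L →ₗ[K] L →ₗ[K] L)
    (𝓛' : ℤ → Submodule K L') (B' : L' →ₗ[K] L' →ₗ[K] L') (e : L ≃ₗ[K] L') : Prop where
  mem_iff : ∀ (i : ℤ) (x : L), e x ∈ 𝓛' i ↔ x ∈ 𝓛 i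
  map_bracket : ∀ x y : L, e (B x y) = B' (e x) (e y)

/-- The shifted grading `M^{*+1}` on `⨁ n, M n`: the summand `M n` sits in degree `n - 1`. -/
def shiftedGrading (K : Type*) [Field K] (M : ℕ → Type*) [∀ n, AddCommGroup (M n)]
    [∀ n, Module K (M n)] (k : ℤ) : Submodule K (⨁ n, M n) where
  carrier := {x | ∀ n : ℕ, (n : ℤ) - 1 ≠ k → x n = 0}
  add_mem' {x y} hx hy n hn := by simp [hx n hn, hy n hn]
  zero_mem' n _ := by simp
  smul_mem' c x hx n hn := by rw [DirectSum.smul_apply, hx n hn, smul_zero]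

/-! ### Substitution of a block of variables

All positions are numbered from `0`, and `N = n + m - 1` is written `N + 1 = n + m`. -/

section Substitution

variable {X : Type*} {n m N : ℕ}

/-- The block `(x_i, …, x_{i+m-1})` of `x = (x_0, …, x_{N-1})`. -/
def blockAt (h : N + 1 = n + m) (i : Fin n) (x : Fin N → X) : Fin m → X :=
  fun k => x ⟨i + k, by omega⟩

/-- The tuple `(x_0, …, x_{i-1}, a, x_{i+m}, …, x_{N-1})`: the block of length `m` starting at
position `i` is replaced by the single entry `a`. -/
def substAt (h : N + 1 = n + m) (i : Fin n) (x : Fin N → X) (a : X) : Fin n → X :=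
  fun j =>
    if h₁ : (j : ℕ) < i then x ⟨j, by omega⟩
    else if h₂ : (j : ℕ) = i then a
    else x ⟨j + m - 1, by omega⟩

/-- The new entry of `substAt h i x a` is at position `i`. -/
theorem substAt_eq_update (h : N + 1 = n + m) (i : Fin n) (x : Fin N → X) (a : X) {a' : X} :
    substAt h i x a = Function.update (substAt h i x a') i a := by
  funext j
  simp only [substAt, Function.update_apply, Fin.ext_iff]
  split_ifs <;> first | rfl | omega

/-- Changing a variable inside the block changes only the block. -/
theorem update_inside (h : N + 1 = n + m) (i : Fin n) (x : Fin N → X) (p : Fin N) (k : Fin m)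
    (hk : (p : ℕ) = i + k) (b : X) :
    blockAt h i (Function.update x p b) = Function.update (blockAt h i x) k b ∧
      ∀ a, substAt h i (Function.update x p b) a = substAt h i x a := by
  refine ⟨?_, fun a => ?_⟩
  · funext l
    simp only [blockAt, Function.update_apply, Fin.ext_iff]
    simp [hk]
  · funext j
    simp only [substAt, Function.update_apply, Fin.ext_iff]
    have := k.2
    split_ifs <;> first | rfl | omega

/-- Changing a variable outside the block changes only one entry of the substituted tuple. -/
theorem update_outside (h : N + 1 = n + m) (i : Fin n) (x : Fin N → X) (p : Fin N)
    (hp : ¬ ∃ k : Fin m, (p : ℕ) = i + k) : ∃ j : Fin n, ∀ b,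
      blockAt h i (Function.update x p b) = blockAt h i x ∧
      ∀ a, substAt h i (Function.update x p b) a = Function.update (substAt h i x a) j b := by
  have hp' : (p : ℕ) < i ∨ i + m ≤ (p : ℕ) := by
    by_contra hc
    exact hp ⟨⟨p - i, by omega⟩, by simp only; omega⟩
  have hj : (if (p : ℕ) < i then (p : ℕ) else p + 1 - m) < n := by split_ifs <;> omega
  refine ⟨⟨_, hj⟩, fun b => ⟨?_, fun a => ?_⟩⟩
  · funext l
    have hl := l.2
    simp only [blockAt, Function.update_apply, Fin.ext_iff]
    rw [if_neg (by omega)]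
  · funext j
    simp only [substAt, Function.update_apply, Fin.ext_iff]
    split_ifs <;> first | rfl | omega

end Substitution

/-! ### The Hochschild complex and the Gerstenhaber bracket -/

section Hochschild

variable (K : Type*) [Field K] (A : Type*) [Ring A] [Algebra K A]

/-- Hochschild cochains `C^n(A) = Hom_K(A^{⊗ n}, A)`, as `n`-multilinear maps. -/
abbrev HochschildCochain (n : ℕ) : Type _ := MultilinearMap K (fun _ : Fin n => A) A

variable {K A} {n m N : ℕ}

/-- The partial composition `f ∘_i g`, namely
`(f ∘_i g)(x_0, …, x_{N-1}) = f(x_0, …, g(x_i, …, x_{i+m-1}), …, x_{N-1})`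
(for `m = 0`, the element `g` of `A` is inserted at position `i`). -/
def HochschildCochain.compAt (h : N + 1 = n + m) (f : HochschildCochain K A n) (i : Fin n)
    (g : HochschildCochain K A m) : HochschildCochain K A N :=
  MultilinearMap.mk' (fun x => f (substAt h i x (g (blockAt h i x))))
    (by
      intro x p a b
      by_cases hp : ∃ k : Fin m, (p : ℕ) = i + k
      · obtain ⟨k, hk⟩ := hp
        have hu := update_inside h i x p k hk
        simp only [(hu _).1, (hu _).2, MultilinearMap.map_update_add]
        rw [substAt_eq_update h i x (_ + _) (a' := 0), MultilinearMap.map_update_add,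
          ← substAt_eq_update, ← substAt_eq_update]
      · obtain ⟨j, hj⟩ := update_outside h i x p hp
        simp only [(hj _).1, (hj _).2, MultilinearMap.map_update_add])
    (by
      intro x p c a
      by_cases hp : ∃ k : Fin m, (p : ℕ) = i + k
      · obtain ⟨k, hk⟩ := hp
        have hu := update_inside h i x p k hk
        simp only [(hu _).1, (hu _).2, MultilinearMap.map_update_smul]
        rw [substAt_eq_update h i x (c • _) (a' := 0), MultilinearMap.map_update_smul,
          ← substAt_eq_update]
      · obtain ⟨j, hj⟩ := update_outside h i x p hp
        simp only [(hj _).1, (hj _).2, MultilinearMap.map_update_smul])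

/-- `f ∘ g = ∑_i (-1)^{i (m-1)} f ∘_i g`, with `i` running over `0, …, n-1`. -/
def HochschildCochain.comp (h : N + 1 = n + m) (f : HochschildCochain K A n)
    (g : HochschildCochain K A m) : HochschildCochain K A N :=
  ∑ i : Fin n, ((i : ℤ) * ((m : ℤ) - 1)).negOnePow • f.compAt h i g

/-- The Gerstenhaber bracket `[f, g] = f ∘ g - (-1)^{(n-1)(m-1)} g ∘ f` of cochains. -/
def HochschildCochain.bracket (h : N + 1 = n + m) (f : HochschildCochain K A n)
    (g : HochschildCochain K A m) : HochschildCochain K A N :=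
  f.comp h g - (((n : ℤ) - 1) * ((m : ℤ) - 1)).negOnePow • g.comp (h.trans (add_comm n m)) f

theorem HochschildCochain.compAt_apply (h : N + 1 = n + m) (f : HochschildCochain K A n)
    (i : Fin n) (g : HochschildCochain K A m) (x : Fin N → A) :
    f.compAt h i g x = f (substAt h i x (g (blockAt h i x))) := rfl

theorem HochschildCochain.compAt_add_left (h : N + 1 = n + m) (f f' : HochschildCochain K A n)
    (i : Fin n) (g : HochschildCochain K A m) :
    (f + f').compAt h i g = f.compAt h i g + f'.compAt h i g := rfl

theorem HochschildCochain.compAt_smul_left (h : N + 1 = n + m) (c : K)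
    (f : HochschildCochain K A n) (i : Fin n) (g : HochschildCochain K A m) :
    (c • f).compAt h i g = c • f.compAt h i g := rfl

theorem HochschildCochain.compAt_add_right (h : N + 1 = n + m) (f : HochschildCochain K A n)
    (i : Fin n) (g g' : HochschildCochain K A m) :
    f.compAt h i (g + g') = f.compAt h i g + f.compAt h i g' := by
  ext x
  change f (substAt h i x (g _ + g' _)) = f (substAt h i x _) + f (substAt h i x _)
  rw [substAt_eq_update h i x (_ + _) (a' := 0), MultilinearMap.map_update_add,
    ← substAt_eq_update, ← substAt_eq_update]

theorem HochschildCochain.compAt_smul_right (h : N + 1 = n + m) (c : K)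
    (f : HochschildCochain K A n) (i : Fin n) (g : HochschildCochain K A m) :
    f.compAt h i (c • g) = c • f.compAt h i g := by
  ext x
  change f (substAt h i x (c • g _)) = c • f (substAt h i x _)
  rw [substAt_eq_update h i x (c • _) (a' := 0), MultilinearMap.map_update_smul,
    ← substAt_eq_update]

variable (K A)

/-- The Hochschild differential
`(δf)(x_0, …, x_n) = x_0 f(x_1, …, x_n) + ∑_{i<n} (-1)^{i+1} f(x_0, …, x_i x_{i+1}, …, x_n)`
`+ (-1)^{n+1} f(x_0, …, x_{n-1}) x_n`, see `hochschildDifferential_apply`. -/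
def hochschildDifferential (n : ℕ) :
    HochschildCochain K A n →ₗ[K] HochschildCochain K A (n + 1) where
  toFun f :=
    HochschildCochain.compAt (by omega) (MultilinearMap.mkPiAlgebraFin K 2 A) 1 f
    + ∑ i : Fin n, (-1 : K) ^ ((i : ℕ) + 1) •
        HochschildCochain.compAt (by omega) f i (MultilinearMap.mkPiAlgebraFin K 2 A)
    + (-1 : K) ^ (n + 1) •
        HochschildCochain.compAt (by omega) (MultilinearMap.mkPiAlgebraFin K 2 A) 0 f
  map_add' f g := by
    simp only [HochschildCochain.compAt_add_left, HochschildCochain.compAt_add_right, smul_add,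
      Finset.sum_add_distrib]
    abel
  map_smul' c f := by
    simp only [HochschildCochain.compAt_smul_left, HochschildCochain.compAt_smul_right, smul_add,
      Finset.smul_sum, RingHom.id_apply, smul_comm c]

theorem hochschildDifferential_apply (n : ℕ) (f : HochschildCochain K A n) (x : Fin (n + 1) → A) :
    hochschildDifferential K A n f x =
      x 0 * f (fun j => x j.succ)
      + ∑ i : Fin n, (-1 : K) ^ ((i : ℕ) + 1) • f (Fin.contractNth i.castSucc (· * ·) x)
      + (-1 : K) ^ (n + 1) • (f (fun j => x j.castSucc) * x (Fin.last n)) := by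
  have hd : hochschildDifferential K A n f x =
      HochschildCochain.compAt (by omega) (MultilinearMap.mkPiAlgebraFin K 2 A) 1 f x
      + (∑ i : Fin n, (-1 : K) ^ ((i : ℕ) + 1) • HochschildCochain.compAt (by omega) f i
          (MultilinearMap.mkPiAlgebraFin K 2 A) : HochschildCochain K A (n + 1)) x
      + (-1 : K) ^ (n + 1) •
        HochschildCochain.compAt (by omega) (MultilinearMap.mkPiAlgebraFin K 2 A) 0 f x := rfl
  rw [hd, sum_apply]
  simp only [smul_apply, HochschildCochain.compAt_apply, MultilinearMap.mkPiAlgebraFin_apply,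
    List.ofFn_succ, List.ofFn_zero, List.prod_cons, List.prod_nil, mul_one]
  congr 1
  · congr 1
    · congr 1
      change f _ = f _
      congr 1
      funext j
      simp only [blockAt]
      congr 1
      ext
      simp [add_comm]
    · refine Finset.sum_congr rfl fun i _ => ?_
      congr 2
      funext j
      simp only [substAt, Fin.contractNth, blockAt, Fin.val_castSucc]
      split_ifs with h₁ h₂
      · rfl
      · congr 2 <;> ext <;> simp [h₂]
      · congr 1
  · congr 2
    · change f _ = f _
      congr 1
      funext j
      simp only [blockAt]
      congr 1
      ext
      simp
    · change x _ = x _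
      congr 1
      ext
      simp

/-- Hochschild cocycles. -/
def hochschildCocycles (n : ℕ) : Submodule K (HochschildCochain K A n) :=
  LinearMap.ker (hochschildDifferential K A n)

/-- Hochschild coboundaries. -/
def hochschildCoboundaries : (n : ℕ) → Submodule K (HochschildCochain K A n)
  | 0 => ⊥
  | n + 1 => LinearMap.range (hochschildDifferential K A n)

/-- Hochschild cohomology `HH^n(A)`: cocycles modulo coboundaries. -/
abbrev HochschildCohomology (n : ℕ) : Type _ :=
  hochschildCocycles K A n ⧸ (hochschildCoboundaries K A n).submoduleOf (hochschildCocycles K A n)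

/-- `HH^*(A) = ⨁ n, HH^n(A)`. -/
abbrev TotalHochschildCohomology : Type _ := ⨁ n, HochschildCohomology K A n

variable {K A}

/-- The class of a cocycle in `HH^n(A)`, as an element of `HH^*(A)`. -/
def hochschildClass {n : ℕ} (f : HochschildCochain K A n) (hf : f ∈ hochschildCocycles K A n) :
    TotalHochschildCohomology K A :=
  DirectSum.of (HochschildCohomology K A) n (Submodule.Quotient.mk ⟨f, hf⟩)

/-- `B` is the bracket on `HH^*(A)` induced by the Gerstenhaber bracket of cochains. The bracket
of two classes of `HH^0(A)` lies in `HH^{-1}(A) = 0`. -/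
structure IsGerstenhaberBracket (B : TotalHochschildCohomology K A →ₗ[K]
    TotalHochschildCohomology K A →ₗ[K] TotalHochschildCohomology K A) : Prop where
  zero_zero : ∀ (f g : HochschildCochain K A 0) (hf : f ∈ hochschildCocycles K A 0)
    (hg : g ∈ hochschildCocycles K A 0), B (hochschildClass f hf) (hochschildClass g hg) = 0
  bracket_class : ∀ {n m N : ℕ} (h : N + 1 = n + m)
    (f : HochschildCochain K A n) (g : HochschildCochain K A m)
    (hf : f ∈ hochschildCocycles K A n) (hg : g ∈ hochschildCocycles K A m),
    ∃ hfg : f.bracket h g ∈ hochschildCocycles K A N,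
      B (hochschildClass f hf) (hochschildClass g hg) = hochschildClass (f.bracket h g) hfg

end Hochschild

/-! ### The bracket on `H^*(G, K) ⊗ KG` -/

section GroupSide

variable {K G : Type u} [Field K] [CommGroup G] {n m N : ℕ}

/-- `γ_i(x_0 | … | x_{N-1}) =`
`α(x_0 | … | x_i x_{i+1} ⋯ x_{i+m-1} y | … | x_{N-1}) β(x_i | … | x_{i+m-1})`. -/
def gammaAt (h : N + 1 = n + m) (α : (Fin n → G) → K) (β : (Fin m → G) → K) (y : G) (i : Fin n) :
    (Fin N → G) → K :=
  fun x => α (substAt h i x ((∏ k, blockAt h i x k) * y)) * β (blockAt h i x)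

/-- `γ_α^{(β,y)} = ∑_i (-1)^{(m-1) i} γ_i`, with `i` running over `0, …, n-1`. -/
def gammaSum (h : N + 1 = n + m) (α : (Fin n → G) → K) (β : (Fin m → G) → K) (y : G) :
    (Fin N → G) → K :=
  ∑ i : Fin n, (((m : ℤ) - 1) * (i : ℤ)).negOnePow • gammaAt h α β y i

/-- The coefficient `γ_α^{(β,y)} - (-1)^{(n-1)(m-1)} γ_β^{(α,x)}` of `xy` in
`[α ⊗ x, β ⊗ y]`. -/
def bracketCoeff (h : N + 1 = n + m) (α : (Fin n → G) → K) (x : G) (β : (Fin m → G) → K) (y : G) :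
    (Fin N → G) → K :=
  gammaSum h α β y
    - (((n : ℤ) - 1) * ((m : ℤ) - 1)).negOnePow • gammaSum (h.trans (add_comm n m)) β α x

/-- `α : G^n → K` is a cocycle for group cohomology with trivial coefficients. -/
def IsGroupCocycle (α : (Fin n → G) → K) : Prop :=
  inhomogeneousCochains.d (Rep.trivial K G K) n α = 0

variable (K G) in
/-- `H^n(G, K) ⊗ KG`. -/
abbrev GroupCohomologyTensor (n : ℕ) : Type u :=
  groupCohomology (Rep.trivial K G K) n ⊗[K] MonoidAlgebra K G

variable (K G) in
/-- `H^*(G, K) ⊗ KG = ⨁ n, H^n(G, K) ⊗ KG`. -/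
abbrev TotalGroupCohomologyTensor : Type u := ⨁ n, GroupCohomologyTensor K G n

/-- The element `[α] ⊗ x` for a cocycle `α : G^n → K` and `x ∈ G`. -/
noncomputable def tensorClass (α : (Fin n → G) → K) (hα : IsGroupCocycle α) (x : G) :
    TotalGroupCohomologyTensor K G :=
  DirectSum.of (GroupCohomologyTensor K G) n
    ((groupCohomology.π (Rep.trivial K G K) n (groupCohomology.cocyclesMk α hα) :
      groupCohomology (Rep.trivial K G K) n) ⊗ₜ[K] MonoidAlgebra.single x (1 : K))

/-- `B` is the bracket on `H^*(G, K) ⊗ KG` induced by the bracket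
`[α ⊗ x, β ⊗ y] = (γ_α^{(β,y)} - (-1)^{(n-1)(m-1)} γ_β^{(α,x)}) ⊗ xy` of cochains. The bracket of
two elements of `H^0(G, K) ⊗ KG` lies in `H^{-1}(G, K) ⊗ KG = 0`. -/
structure IsTransferredBracket (B : TotalGroupCohomologyTensor K G →ₗ[K]
    TotalGroupCohomologyTensor K G →ₗ[K] TotalGroupCohomologyTensor K G) : Prop where
  zero_zero : ∀ (α β : (Fin 0 → G) → K) (hα : IsGroupCocycle α) (hβ : IsGroupCocycle β)
    (x y : G), B (tensorClass α hα x) (tensorClass β hβ y) = 0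
  bracket_class : ∀ {n m N : ℕ} (h : N + 1 = n + m)
    (α : (Fin n → G) → K) (β : (Fin m → G) → K)
    (hα : IsGroupCocycle α) (hβ : IsGroupCocycle β) (x y : G),
    ∃ hαβ : IsGroupCocycle (bracketCoeff h α x β y),
      B (tensorClass α hα x) (tensorClass β hβ y) =
        tensorClass (bracketCoeff h α x β y) hαβ (x * y)

end GroupSide

/-! In the basis `G` of `KG`, a cochain `f` is the same as a family of functions `f_y`, `y ∈ G`,
with `f(x₁, …, xₙ) = ∑ y, f_y(x₁, …, xₙ) x₁⋯xₙ y`. Measuring values against the product `x₁⋯xₙ` is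
the point: since `G` is abelian, no term of the Hochschild differential moves `y`, and each `f_y` is
subject to the group differential with trivial coefficients (`coeffCochain_hochschildDifferential`).
As `G` is finite, the Hochschild complex is the group complex tensored with `KG`, whence `HH^n(KG) ≃
H^n(G, K) ⊗ KG`.

Under this identification the bracket on the group side is the Gerstenhaber bracket already on
cochains: inserting the cochain of `(β, y)` into slot `i` of that of `(α, x)` gives the cochain of
`(γ_i, xy)` (`compAt_monomialCochain`, `bracket_monomialCochain`). Well-definedness and the Lie
axioms on the group side are therefore transported from `HH`.

For an arbitrary algebra, `∘` is graded pre-Lie: the terms of `(f ∘ g) ∘ k` with `k` inside `g` form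
`f ∘ (g ∘ k)`, and the others, with `g` and `k` in different slots of `f`, are symmetric up to sign.
The commutator of a pre-Lie product is a graded Lie bracket, and the extra axioms hold without
division by `2` or `3`. Finally `δ = -[·, μ]` for the multiplication `μ`, so the Jacobi identity
makes `δ` a derivation: cocycles form a subalgebra, and coboundaries that are cocycles form an ideal
in it. -/

/-! ### The pre-Lie identity for Hochschild cochains -/

section PreLie

variable {K : Type*} [Field K] {A : Type*} [Ring A] [Algebra K A]
variable {n m l N N' Q P : ℕ}

namespace HochschildCochain

/-- Composing inside the block of the first composition. -/
theorem compAt_compAt_inside (h₁ : N + 1 = n + m) (h₂ : P + 1 = N + l) (h₃ : Q + 1 = m + l)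
    (h₄ : P + 1 = n + Q) (f : HochschildCochain K A n) (g : HochschildCochain K A m)
    (k : HochschildCochain K A l) (i : Fin n) (r : Fin m) (j : Fin N) (hj : (j : ℕ) = i + r) :
    (f.compAt h₁ i g).compAt h₂ j k = f.compAt h₄ i (g.compAt h₃ r k) := by
  ext x
  simp only [compAt_apply]
  have hr := r.2
  have hk : blockAt h₂ j x = blockAt h₃ r (blockAt h₄ i x) := by
    funext t
    simp only [blockAt]
    congr 2
    omega
  have hg : blockAt h₁ i (substAt h₂ j x (k (blockAt h₂ j x))) =
      substAt h₃ r (blockAt h₄ i x) (k (blockAt h₃ r (blockAt h₄ i x))) := by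
    rw [hk]
    funext t
    simp only [blockAt, substAt]
    split_ifs <;> first | rfl | omega | (congr 2; omega)
  rw [hg]
  congr 1
  funext t
  simp only [substAt]
  split_ifs <;> first | rfl | omega | (congr 2; omega)

/-- Composing to the left of the block of the first composition. -/
theorem compAt_compAt_left (h₁ : N + 1 = n + m) (h₂ : P + 1 = N + l) (h₃ : N' + 1 = n + l)
    (h₄ : P + 1 = N' + m) (f : HochschildCochain K A n) (g : HochschildCochain K A m)
    (k : HochschildCochain K A l) (i j' : Fin n) (j : Fin N) (i' : Fin N')
    (hj : (j : ℕ) = j') (hij : (j : ℕ) < i) (hi' : (i' : ℕ) + 1 = i + l) :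
    (f.compAt h₁ i g).compAt h₂ j k = (f.compAt h₃ j' k).compAt h₄ i' g := by
  ext x
  simp only [compAt_apply]
  have hg : blockAt h₁ i (substAt h₂ j x (k (blockAt h₂ j x))) = blockAt h₄ i' x := by
    funext t
    simp only [blockAt, substAt]
    split_ifs <;> first | rfl | omega | (congr 2; omega)
  have hk : blockAt h₃ j' (substAt h₄ i' x (g (blockAt h₄ i' x))) = blockAt h₂ j x := by
    funext t
    have ht := t.2
    simp only [blockAt, substAt]
    split_ifs <;> first | rfl | omega | (congr 2; omega)
  rw [hg, hk]
  congr 1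
  funext t
  simp only [substAt]
  split_ifs <;> first | rfl | omega | (congr 2; omega)

variable (K A) in
/-- `comp` as a bilinear map. -/
def compₗ (h : N + 1 = n + m) :
    HochschildCochain K A n →ₗ[K] HochschildCochain K A m →ₗ[K] HochschildCochain K A N :=
  LinearMap.mk₂ K (fun f g => f.comp h g)
    (fun f f' g => by simp only [comp, compAt_add_left, smul_add, Finset.sum_add_distrib])
    (fun c f g => by simp only [comp, compAt_smul_left, Finset.smul_sum, smul_comm c])
    (fun f g g' => by simp only [comp, compAt_add_right, smul_add, Finset.sum_add_distrib])
    (fun c f g => by simp only [comp, compAt_smul_right, Finset.smul_sum, smul_comm c])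

variable (K A) in
/-- `compAt` as a bilinear map. -/
def compAtₗ (h : N + 1 = n + m) (i : Fin n) :
    HochschildCochain K A n →ₗ[K] HochschildCochain K A m →ₗ[K] HochschildCochain K A N :=
  LinearMap.mk₂ K (fun f g => f.compAt h i g)
    (fun f f' g => compAt_add_left h f f' i g)
    (fun c f g => compAt_smul_left h c f i g)
    (fun f g g' => compAt_add_right h f i g g')
    (fun c f g => compAt_smul_right h c f i g)

theorem compAtₗ_apply (h : N + 1 = n + m) (i : Fin n) (f : HochschildCochain K A n)
    (g : HochschildCochain K A m) : compAtₗ K A h i f g = f.compAt h i g := rfl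

/-- The term of `(f ∘ g) ∘ k` with indices `(i, j)`. -/
def compTerm (h₁ : N + 1 = n + m) (h₂ : P + 1 = N + l)
    (f : HochschildCochain K A n) (g : HochschildCochain K A m)
    (k : HochschildCochain K A l) (p : Fin n × Fin N) : HochschildCochain K A P :=
  ((p.1 : ℤ) * ((m : ℤ) - 1) + (p.2 : ℤ) * ((l : ℤ) - 1)).negOnePow •
    (f.compAt h₁ p.1 g).compAt h₂ p.2 k

theorem comp_comp (h₁ : N + 1 = n + m) (h₂ : P + 1 = N + l)
    (f : HochschildCochain K A n) (g : HochschildCochain K A m) (k : HochschildCochain K A l) :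
    (f.comp h₁ g).comp h₂ k = ∑ p : Fin n × Fin N, compTerm h₁ h₂ f g k p := by
  rw [Fintype.sum_prod_type_right]
  unfold comp compTerm
  refine Finset.sum_congr rfl fun j _ => ?_
  rw [← compAtₗ_apply, map_sum, LinearMap.sum_apply, Finset.smul_sum]
  refine Finset.sum_congr rfl fun i _ => ?_
  rw [LinearMap.map_smul_of_tower, LinearMap.smul_apply, compAtₗ_apply, smul_smul,
    Int.negOnePow_add, mul_comm]

/-- The terms of `(f ∘ g) ∘ k` in which `k` is inserted to the left of `g`. -/
def leftTerms (h₁ : N + 1 = n + m) (h₂ : P + 1 = N + l)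
    (f : HochschildCochain K A n) (g : HochschildCochain K A m)
    (k : HochschildCochain K A l) : HochschildCochain K A P :=
  ∑ p : Fin n × Fin N with (p.2 : ℕ) < p.1, compTerm h₁ h₂ f g k p

/-- The terms of `(f ∘ g) ∘ k` in which `k` is inserted to the right of `g`. -/
def rightTerms (h₁ : N + 1 = n + m) (h₂ : P + 1 = N + l)
    (f : HochschildCochain K A n) (g : HochschildCochain K A m)
    (k : HochschildCochain K A l) : HochschildCochain K A P :=
  ∑ p : Fin n × Fin N with (p.1 : ℕ) + m ≤ p.2, compTerm h₁ h₂ f g k p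

/-- The terms of `(f ∘ g) ∘ k` in which `k` is inserted into `g`. -/
def insideTerms (h₁ : N + 1 = n + m) (h₂ : P + 1 = N + l)
    (f : HochschildCochain K A n) (g : HochschildCochain K A m)
    (k : HochschildCochain K A l) : HochschildCochain K A P :=
  ∑ p : Fin n × Fin N with (p.1 : ℕ) ≤ p.2 ∧ (p.2 : ℕ) < p.1 + m, compTerm h₁ h₂ f g k p

/-- The arguments of `g` occupy positions `i, …, i + m - 1` of `f ∘_i g`, so `k` goes in before,
within or after them. -/
theorem comp_comp_eq_add (h₁ : N + 1 = n + m) (h₂ : P + 1 = N + l)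
    (f : HochschildCochain K A n) (g : HochschildCochain K A m) (k : HochschildCochain K A l) :
    (f.comp h₁ g).comp h₂ k =
      leftTerms h₁ h₂ f g k + insideTerms h₁ h₂ f g k + rightTerms h₁ h₂ f g k := by
  rw [comp_comp, leftTerms, insideTerms, rightTerms, Finset.sum_filter, Finset.sum_filter,
    Finset.sum_filter, ← Finset.sum_add_distrib, ← Finset.sum_add_distrib]
  refine Finset.sum_congr rfl fun p _ => ?_
  split_ifs <;> first | omega | simp

/-- Insertions into different slots of `f` can be made in either order, so `k` to the left of `g` is
`g` to the right of `k`. This is the symmetry of the associator. -/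
theorem leftTerms_eq (h₁ : N + 1 = n + m) (h₂ : P + 1 = N + l) (h₃ : N' + 1 = n + l)
    (h₄ : P + 1 = N' + m)
    (f : HochschildCochain K A n) (g : HochschildCochain K A m) (k : HochschildCochain K A l) :
    leftTerms h₁ h₂ f g k =
      (((m : ℤ) - 1) * ((l : ℤ) - 1)).negOnePow • rightTerms h₃ h₄ f k g := by
  rw [leftTerms, rightTerms, Finset.smul_sum]
  -- Filling slot `j < i` with `k` first moves slot `i` of `f` to `i + l - 1`; the subtraction is
  -- not truncated because `i > 0`.
  refine Finset.sum_bij'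
    (fun p hp => (⟨p.2, by have := (Finset.mem_filter.1 hp).2; omega⟩,
      ⟨p.1 + l - 1, by have := (Finset.mem_filter.1 hp).2; omega⟩))
    (fun p hp => (⟨p.2 + 1 - l, by have := (Finset.mem_filter.1 hp).2; omega⟩,
      ⟨p.1, by have := (Finset.mem_filter.1 hp).2; omega⟩)) ?_ ?_ ?_ ?_ ?_
  · intro p hp
    have := (Finset.mem_filter.1 hp).2
    simp only [Finset.mem_filter, Finset.mem_univ, true_and]
    omega
  · intro p hp
    have := (Finset.mem_filter.1 hp).2
    simp only [Finset.mem_filter, Finset.mem_univ, true_and]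
    omega
  · intro p hp
    have := (Finset.mem_filter.1 hp).2
    ext <;> simp only
    omega
  · intro p hp
    have := (Finset.mem_filter.1 hp).2
    ext <;> simp only
    omega
  · rintro ⟨i, j⟩ hp
    have hij := (Finset.mem_filter.1 hp).2
    simp only at hij
    simp only [compTerm, smul_smul]
    rw [compAt_compAt_left h₁ h₂ h₃ h₄ f g k i ⟨j, by omega⟩ j ⟨i + l - 1, by omega⟩ rfl hij
      (by simp only; omega), ← Int.negOnePow_add]
    congr 1
    rw [Int.negOnePow_eq_iff]
    have : ((i + l - 1 : ℕ) : ℤ) = i + l - 1 := by omega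
    rw [this]
    -- The prefactor and the shift of `i` by `l - 1` contribute `(m - 1)(l - 1)` each, so the
    -- exponents differ by twice that.
    refine ⟨-(((m : ℤ) - 1) * ((l : ℤ) - 1)), ?_⟩
    ring

/-- Position `i + r` of `f ∘_i g` is slot `r` of `g`. The exponents agree exactly, since `Q - 1 = (m
- 1) + (l - 1)`. -/
theorem insideTerms_eq (h₁ : N + 1 = n + m) (h₂ : P + 1 = N + l) (h₃ : Q + 1 = m + l)
    (h₄ : P + 1 = n + Q)
    (f : HochschildCochain K A n) (g : HochschildCochain K A m) (k : HochschildCochain K A l) :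
    insideTerms h₁ h₂ f g k = f.comp h₄ (g.comp h₃ k) := by
  have hr : f.comp h₄ (g.comp h₃ k) = ∑ p : Fin n × Fin m,
      ((p.1 : ℤ) * ((Q : ℤ) - 1) + (p.2 : ℤ) * ((l : ℤ) - 1)).negOnePow •
        f.compAt h₄ p.1 (g.compAt h₃ p.2 k) := by
    rw [Fintype.sum_prod_type]
    unfold comp
    refine Finset.sum_congr rfl fun i _ => ?_
    rw [← compAtₗ_apply, map_sum, Finset.smul_sum]
    refine Finset.sum_congr rfl fun r _ => ?_
    rw [LinearMap.map_smul_of_tower, compAtₗ_apply, smul_smul, Int.negOnePow_add]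
  rw [hr, insideTerms]
  refine Finset.sum_bij'
    (fun p hp => (p.1, ⟨p.2 - p.1, by have := (Finset.mem_filter.1 hp).2; omega⟩))
    (fun p hp => (p.1, ⟨p.1 + p.2, by omega⟩)) ?_ ?_ ?_ ?_ ?_
  · intro p hp
    exact Finset.mem_univ _
  · intro p hp
    simp only [Finset.mem_filter, Finset.mem_univ, true_and]
    omega
  · intro p hp
    have := (Finset.mem_filter.1 hp).2
    ext <;> simp only
    omega
  · intro p hp
    ext <;> simp only
    omega
  · rintro ⟨i, j⟩ hp
    have hij := (Finset.mem_filter.1 hp).2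
    simp only at hij
    simp only [compTerm]
    rw [compAt_compAt_inside h₁ h₂ h₃ h₄ f g k i ⟨j - i, by omega⟩ j (by simp only; omega)]
    congr 1
    rw [Int.negOnePow_eq_iff]
    have : ((j - i : ℕ) : ℤ) = j - i := by omega
    have hQ : (Q : ℤ) = m + l - 1 := by omega
    rw [this, hQ]
    refine ⟨0, ?_⟩
    ring

/-- A cochain with no arguments has no slots. This covers `m = l = 0`, where `g ∘ k` would have `-1`
arguments. -/
theorem insideTerms_eq_zero (h₁ : N + 1 = n + 0) (h₂ : P + 1 = N + l)
    (f : HochschildCochain K A n) (g : HochschildCochain K A 0) (k : HochschildCochain K A l) :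
    insideTerms h₁ h₂ f g k = 0 := by
  rw [insideTerms, Finset.filter_false_of_mem, Finset.sum_empty]
  intro p _
  omega

theorem zero_comp (h : N + 1 = 0 + m) (f : HochschildCochain K A 0) (g : HochschildCochain K A m) :
    f.comp h g = 0 := by
  simp [comp]

end HochschildCochain

end PreLie

/-! ### Graded pre-Lie algebras and their commutators -/

section GradedPreLie

variable {K L : Type*} [Field K] [AddCommGroup L] [Module K L]

/-- `circ` is a graded (right) pre-Lie product: it has degree zero and its associator is graded
symmetric in the last two variables. -/
structure IsGradedPreLie (𝓛 : ℤ → Submodule K L) (circ : L →ₗ[K] L →ₗ[K] L) : Prop where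
  circ_mem : ∀ {i j : ℤ} {x y : L}, x ∈ 𝓛 i → y ∈ 𝓛 j → circ x y ∈ 𝓛 (i + j)
  associator : ∀ {i j k : ℤ} {x y z : L}, x ∈ 𝓛 i → y ∈ 𝓛 j → z ∈ 𝓛 k →
    circ (circ x y) z - circ x (circ y z) =
      (j * k).negOnePow • (circ (circ x z) y - circ x (circ z y))

/-- `br` is the graded commutator of `circ`. -/
structure IsGradedCommutator (𝓛 : ℤ → Submodule K L) (circ br : L →ₗ[K] L →ₗ[K] L) :
    Prop where
  bracket_eq : ∀ {i j : ℤ} {x y : L}, x ∈ 𝓛 i → y ∈ 𝓛 j →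
    br x y = circ x y - (i * j).negOnePow • circ y x

namespace IsGradedCommutator

variable {𝓛 : ℤ → Submodule K L} {circ br : L →ₗ[K] L →ₗ[K] L} {i j k : ℤ} {x y z : L}

theorem bracket_mem (hb : IsGradedCommutator 𝓛 circ br) (hc : IsGradedPreLie 𝓛 circ)
    (hx : x ∈ 𝓛 i) (hy : y ∈ 𝓛 j) : br x y ∈ 𝓛 (i + j) := by
  rw [hb.bracket_eq hx hy, Units.smul_def]
  exact sub_mem (hc.circ_mem hx hy) (zsmul_mem (add_comm j i ▸ hc.circ_mem hy hx) _)

theorem antisymm (hb : IsGradedCommutator 𝓛 circ br) (hx : x ∈ 𝓛 i) (hy : y ∈ 𝓛 j) :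
    br x y = -((i * j).negOnePow • br y x) := by
  rw [hb.bracket_eq hx hy, hb.bracket_eq hy hx, mul_comm j i, smul_sub, smul_smul, Int.units_mul_self, one_smul]
  abel

theorem bracket_self (hb : IsGradedCommutator 𝓛 circ br) (hi : Even i) (hx : x ∈ 𝓛 i) :
    br x x = 0 := by
  rw [hb.bracket_eq hx hx, Int.negOnePow_even _ (hi.mul_left i), one_smul, sub_self]

/-- Expanded in `circ`, the identity is a signed sum of three associator symmetries, one for each
choice of the outermost left factor. -/
theorem jacobi (hb : IsGradedCommutator 𝓛 circ br) (hc : IsGradedPreLie 𝓛 circ)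
    (hx : x ∈ 𝓛 i) (hy : y ∈ 𝓛 j) (hz : z ∈ 𝓛 k) :
    br x (br y z) = br (br x y) z + (i * j).negOnePow • br y (br x z) := by
  rw [hb.bracket_eq hx (hb.bracket_mem hc hy hz), hb.bracket_eq (hb.bracket_mem hc hx hy) hz,
    hb.bracket_eq hy (hb.bracket_mem hc hx hz), hb.bracket_eq hx hy, hb.bracket_eq hy hz, hb.bracket_eq hx hz]
  have h₁ := hc.associator hx hy hz
  have h₂ := hc.associator hy hz hx
  have h₃ := hc.associator hz hx hy
  rw [mul_comm k i] at h₂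
  simp only [mul_add, add_mul, Int.negOnePow_add]
  rw [mul_comm j i]
  -- With the three signs fixed, `module` sees only integer coefficients; the signs of `h₂` and `h₃`
  -- in the combination depend on the case.
  rcases Int.units_eq_one_or (i * j).negOnePow with ha | ha <;>
  rcases Int.units_eq_one_or (i * k).negOnePow with hb | hb <;>
  rcases Int.units_eq_one_or (j * k).negOnePow with hc | hc <;>
  · simp only [ha, hb, hc, one_smul, Units.neg_smul, map_sub, map_neg, LinearMap.sub_apply,
      LinearMap.neg_apply, mul_one, mul_neg, neg_neg] at h₁ h₂ h₃ ⊢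
    first
    | linear_combination (norm := module) -h₁ - h₂ - h₃
    | linear_combination (norm := module) -h₁ + h₂ - h₃
    | linear_combination (norm := module) -h₁ - h₂ + h₃
    | linear_combination (norm := module) -h₁ + h₂ + h₃

/-- For odd degree `[x, x] = 2 x ∘ x`, so `[x, [x, x]]` is `-2` times the associator of `x, x, x`,
and graded symmetry says that this associator equals its own negative. -/
theorem bracket_bracket_self (hb : IsGradedCommutator 𝓛 circ br) (hc : IsGradedPreLie 𝓛 circ)
    (hi : Odd i) (hx : x ∈ 𝓛 i) : br x (br x x) = 0 := by
  have h := hc.associator hx hx hx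
  rw [hb.bracket_eq hx (hb.bracket_mem hc hx hx), hb.bracket_eq hx hx, Int.negOnePow_even (i * (i + i)) ?_]
  · rw [Int.negOnePow_odd _ (hi.mul hi)] at h ⊢
    simp only [one_smul, Units.neg_smul, map_sub, map_neg, LinearMap.sub_apply,
      LinearMap.neg_apply] at h ⊢
    linear_combination (norm := module) -h
  · exact (Even.add_self i).mul_left i

/-- The inner map `x ↦ -[x, u]` is a graded derivation. -/
theorem neg_bracket_bracket (hb : IsGradedCommutator 𝓛 circ br) (hc : IsGradedPreLie 𝓛 circ)
    (hx : x ∈ 𝓛 i) (hy : y ∈ 𝓛 j) (hz : z ∈ 𝓛 1) :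
    -br (br x y) z = br x (-br y z) + j.negOnePow • br (-br x z) y := by
  have h := hb.jacobi hc hx hy hz
  have h' := hb.antisymm hy (hb.bracket_mem hc hx hz)
  -- Moving `y` past `[x, z]`, of degree `i + 1`, turns the sign `(-1)^{ij}` of Jacobi into
  -- `(-1)^{ij + j(i+1)} = (-1)^j`.
  rw [h', smul_neg, smul_smul, ← Int.negOnePow_add,
    show i * j + j * (i + 1) = 2 * (i * j) + j by ring, Int.negOnePow_add,
    Int.negOnePow_two_mul, one_mul] at h
  rw [map_neg, map_neg, LinearMap.neg_apply, h, smul_neg]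
  abel

end IsGradedCommutator

end GradedPreLie

/-! ### The shifted grading -/

section ShiftedGrading

variable {K : Type*} [Field K] {M : ℕ → Type*} [∀ n, AddCommGroup (M n)] [∀ n, Module K (M n)]

theorem of_mem_shiftedGrading {n : ℕ} (a : M n) :
    DirectSum.of M n a ∈ shiftedGrading K M ((n : ℤ) - 1) := by
  intro n' hn'
  exact DirectSum.of_eq_of_ne _ _ _ (by omega)

theorem of_mem_shiftedGrading' {n : ℕ} {k : ℤ} (hk : (n : ℤ) - 1 = k) (a : M n) :
    DirectSum.of M n a ∈ shiftedGrading K M k :=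
  hk ▸ of_mem_shiftedGrading a

/-- Reduces identities between homogeneous elements to single summands; degrees below `-1` contain
only zero. -/
theorem eq_zero_or_exists_of_mem_shiftedGrading {k : ℤ} {x : ⨁ n, M n}
    (hx : x ∈ shiftedGrading K M k) :
    x = 0 ∨ ∃ (n : ℕ) (a : M n), k = (n : ℤ) - 1 ∧ x = DirectSum.of M n a := by
  by_cases h : ∃ n : ℕ, k = (n : ℤ) - 1
  · obtain ⟨n, rfl⟩ := h
    refine Or.inr ⟨n, x n, rfl, ?_⟩
    refine DirectSum.ext_component K fun n' => ?_
    change x n' = DirectSum.of M n (x n) n'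
    obtain rfl | hn := eq_or_ne n' n
    · rw [DirectSum.of_eq_same]
    · rw [DirectSum.of_eq_of_ne _ _ _ hn, hx n' (by omega)]
  · left
    refine DirectSum.ext_component K fun n => ?_
    exact hx n fun hn => h ⟨n, hn.symm⟩

theorem coeLinearMap_shiftedGrading_apply (x : ⨁ k, shiftedGrading K M k) (n : ℕ) :
    DirectSum.coeLinearMap (shiftedGrading K M) x n = (x ((n : ℤ) - 1) : ⨁ n, M n) n := by
  induction x using DirectSum.induction_on with
  | zero => simp
  | of k y =>
    rw [← DirectSum.lof_eq_of K, DirectSum.coeLinearMap_lof, DirectSum.lof_eq_of]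
    obtain rfl | hk := eq_or_ne ((n : ℤ) - 1) k
    · rw [DirectSum.of_eq_same]
    · rw [DirectSum.of_eq_of_ne _ _ _ hk, y.2 n hk]
      rfl
  | add x y hx hy => simp [hx, hy]

theorem isInternal_shiftedGrading : DirectSum.IsInternal (shiftedGrading K M) := by
  refine ⟨fun x y hxy => ?_, fun x => ?_⟩
  · change DirectSum.coeLinearMap _ x = DirectSum.coeLinearMap _ y at hxy
    refine DirectSum.ext_component K fun k => Subtype.ext ?_
    refine DirectSum.ext_component K fun n => ?_
    change (x k : ⨁ n, M n) n = (y k : ⨁ n, M n) n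
    obtain rfl | hk := eq_or_ne ((n : ℤ) - 1) k
    · rw [← coeLinearMap_shiftedGrading_apply, ← coeLinearMap_shiftedGrading_apply, hxy]
    · rw [(x k).2 n hk, (y k).2 n hk]
  · change ∃ y, DirectSum.coeLinearMap _ y = x
    induction x using DirectSum.induction_on with
    | zero => exact ⟨0, map_zero _⟩
    | of n a =>
      exact ⟨DirectSum.lof K ℤ (fun k => shiftedGrading K M k) _ ⟨_, of_mem_shiftedGrading a⟩,
        DirectSum.coeLinearMap_lof _ _ _⟩
    | add x y hx hy =>
      obtain ⟨x', rfl⟩ := hx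
      obtain ⟨y', rfl⟩ := hy
      exact ⟨x' + y', map_add _ _ _⟩

/-- The bilinear map on a direct sum with given components. -/
def DirectSum.bilinear {P : Type*} [AddCommGroup P] [Module K P]
    (c : ∀ n m, M n →ₗ[K] M m →ₗ[K] P) : (⨁ n, M n) →ₗ[K] (⨁ n, M n) →ₗ[K] P :=
  DirectSum.toModule K ℕ _ fun n =>
    (DirectSum.toModule K ℕ (M n →ₗ[K] P) fun m => (c n m).flip).flip

@[simp] theorem DirectSum.bilinear_of_of {P : Type*} [AddCommGroup P] [Module K P]
    (c : ∀ n m, M n →ₗ[K] M m →ₗ[K] P) {n m : ℕ} (x : M n) (y : M m) :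
    DirectSum.bilinear c (DirectSum.of M n x) (DirectSum.of M m y) = c n m x y := by
  simp only [← DirectSum.lof_eq_of K, DirectSum.bilinear, DirectSum.toModule_lof,
    LinearMap.flip_apply]

theorem DirectSum.bilinear_ext {P : Type*} [AddCommGroup P] [Module K P]
    {b b' : (⨁ n, M n) →ₗ[K] (⨁ n, M n) →ₗ[K] P}
    (h : ∀ (n m : ℕ) (x : M n) (y : M m),
      b (DirectSum.of M n x) (DirectSum.of M m y) = b' (DirectSum.of M n x) (DirectSum.of M m y)) :
    b = b' := by
  refine DirectSum.linearMap_ext K fun n => LinearMap.ext fun x => ?_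
  refine DirectSum.linearMap_ext K fun m => LinearMap.ext fun y => ?_
  exact h n m x y

end ShiftedGrading

/-! ### The Lie structure on the total space of Hochschild cochains -/

section TotalCochains

variable (K : Type*) [Field K] (A : Type*) [Ring A] [Algebra K A]

/-- `⨁ n, C^n(A)`. -/
abbrev TotalHochschildCochain : Type _ := ⨁ n, HochschildCochain K A n

namespace TotalHochschildCochain

/-- The composition product `f ∘ g` on `⨁ n, C^n(A)`. -/
def circ : TotalHochschildCochain K A →ₗ[K] TotalHochschildCochain K A →ₗ[K]
    TotalHochschildCochain K A :=
  DirectSum.bilinear fun n m =>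
    -- The test fails only for `n = m = 0`, where truncated subtraction gives `0` in place of `-1`;
    -- the product is then zero.
    if h : n + m - 1 + 1 = n + m then
      (HochschildCochain.compₗ K A h).compr₂ (DirectSum.lof K ℕ (HochschildCochain K A) (n + m - 1))
    else 0

/-- The Gerstenhaber bracket on `⨁ n, C^n(A)`. -/
def bracket : TotalHochschildCochain K A →ₗ[K] TotalHochschildCochain K A →ₗ[K]
    TotalHochschildCochain K A :=
  -- The sign depends on both degrees, so the opposite product is twisted component by component.
  circ K A - DirectSum.bilinear fun n m => (((n : ℤ) - 1) * ((m : ℤ) - 1)).negOnePow •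
    ((circ K A).flip.compl₁₂ (DirectSum.lof K ℕ (HochschildCochain K A) n)
      (DirectSum.lof K ℕ (HochschildCochain K A) m))

variable {K A} {n m N : ℕ}

theorem circ_of_of (h : N + 1 = n + m) (f : HochschildCochain K A n)
    (g : HochschildCochain K A m) :
    circ K A (DirectSum.of _ n f) (DirectSum.of _ m g) = DirectSum.of _ N (f.comp h g) := by
  obtain rfl : N = n + m - 1 := by omega
  rw [circ, DirectSum.bilinear_of_of, dif_pos h]
  rfl

theorem circ_of_zero (f : HochschildCochain K A 0) (x : TotalHochschildCochain K A) :
    circ K A (DirectSum.of _ 0 f) x = 0 := by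
  induction x using DirectSum.induction_on with
  | zero => simp
  | add x y hx hy => rw [map_add, hx, hy, add_zero]
  | of m g =>
    obtain rfl | m := m
    · rw [circ, DirectSum.bilinear_of_of, dif_neg (by omega)]
      rfl
    · rw [circ_of_of (N := m) (by omega), HochschildCochain.zero_comp, map_zero]

theorem bracket_of_of' (f : HochschildCochain K A n) (g : HochschildCochain K A m) :
    bracket K A (DirectSum.of _ n f) (DirectSum.of _ m g) =
      circ K A (DirectSum.of _ n f) (DirectSum.of _ m g) -
        (((n : ℤ) - 1) * ((m : ℤ) - 1)).negOnePow •
          circ K A (DirectSum.of _ m g) (DirectSum.of _ n f) := by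
  rw [bracket, LinearMap.sub_apply, LinearMap.sub_apply, DirectSum.bilinear_of_of]
  rfl

theorem bracket_of_of (h : N + 1 = n + m) (f : HochschildCochain K A n)
    (g : HochschildCochain K A m) :
    bracket K A (DirectSum.of _ n f) (DirectSum.of _ m g) = DirectSum.of _ N (f.bracket h g) := by
  rw [bracket_of_of', circ_of_of h, circ_of_of (h.trans (add_comm n m)),
    HochschildCochain.bracket, map_sub, Units.smul_def, Units.smul_def, map_zsmul]

theorem bracket_of_zero_of_zero (f g : HochschildCochain K A 0) :
    bracket K A (DirectSum.of _ 0 f) (DirectSum.of _ 0 g) = 0 := by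
  rw [bracket_of_of', circ_of_zero, circ_of_zero, smul_zero, sub_zero]

variable (K A)

theorem isGradedCommutator :
    IsGradedCommutator (shiftedGrading K (HochschildCochain K A)) (circ K A) (bracket K A) := by
  refine ⟨fun {i j x y} hx hy => ?_⟩
  obtain rfl | ⟨n, f, rfl, rfl⟩ := eq_zero_or_exists_of_mem_shiftedGrading hx
  · simp
  obtain rfl | ⟨m, g, rfl, rfl⟩ := eq_zero_or_exists_of_mem_shiftedGrading hy
  · simp
  exact bracket_of_of' f g

theorem isGradedPreLie :
    IsGradedPreLie (shiftedGrading K (HochschildCochain K A)) (circ K A) where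
  circ_mem := by
    intro i j x y hx hy
    obtain rfl | ⟨n, f, rfl, rfl⟩ := eq_zero_or_exists_of_mem_shiftedGrading hx
    · simp
    obtain rfl | ⟨m, g, rfl, rfl⟩ := eq_zero_or_exists_of_mem_shiftedGrading hy
    · simp
    obtain rfl | n := n
    · rw [circ_of_zero]
      exact zero_mem _
    rw [circ_of_of (N := n + m) (by omega)]
    exact of_mem_shiftedGrading' (by push_cast; ring) _
  associator := by
    intro i j k x y z hx hy hz
    obtain rfl | ⟨n, f, rfl, rfl⟩ := eq_zero_or_exists_of_mem_shiftedGrading hx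
    · simp
    obtain rfl | ⟨m, g, rfl, rfl⟩ := eq_zero_or_exists_of_mem_shiftedGrading hy
    · simp
    obtain rfl | ⟨l, k, rfl, rfl⟩ := eq_zero_or_exists_of_mem_shiftedGrading hz
    · simp
    obtain rfl | n := n
    · simp [circ_of_zero]
    have h₁ : n + m + 1 = n + 1 + m := by omega
    have h₂ : n + l + 1 = n + 1 + l := by omega
    rw [circ_of_of h₁, circ_of_of h₂]
    -- For `m = l = 0` both inner products vanish by degree, and the inside terms are empty, so only
    -- left and right terms remain.
    by_cases h0 : m + l = 0
    · obtain rfl : m = 0 := by omega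
      obtain rfl : l = 0 := by omega
      rw [circ_of_zero, circ_of_zero]
      obtain rfl | n := n
      · simp [circ_of_zero]
      have h₃ : n + 1 = n + 1 + 0 + 0 := by omega
      rw [circ_of_of h₃, circ_of_of h₃, HochschildCochain.comp_comp_eq_add,
        HochschildCochain.comp_comp_eq_add, HochschildCochain.insideTerms_eq_zero,
        HochschildCochain.insideTerms_eq_zero, HochschildCochain.leftTerms_eq _ _ h₁ h₃ f g k,
        HochschildCochain.leftTerms_eq _ _ h₁ h₃ f k g]
      simp [add_comm]
    · have h₃ : n + m + l - 1 + 1 = n + m + l := by omega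
      have h₄ : n + m + l - 1 + 1 = n + l + m := by omega
      have h₅ : m + l - 1 + 1 = m + l := by omega
      have h₆ : m + l - 1 + 1 = l + m := by omega
      have h₇ : n + m + l - 1 + 1 = n + 1 + (m + l - 1) := by omega
      rw [circ_of_of h₃, circ_of_of h₄, circ_of_of h₅, circ_of_of h₆, circ_of_of h₇,
        circ_of_of h₇, HochschildCochain.comp_comp_eq_add,
        HochschildCochain.comp_comp_eq_add, HochschildCochain.insideTerms_eq h₁ h₃ h₅ h₇,
        HochschildCochain.insideTerms_eq h₂ h₄ h₆ h₇,
        HochschildCochain.leftTerms_eq h₁ h₃ h₂ h₄ f g k,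
        HochschildCochain.leftTerms_eq h₂ h₄ h₁ h₃ f k g, mul_comm ((l : ℤ) - 1)]
      simp only [Units.smul_def, ← map_sub, ← map_zsmul]
      congr 1
      rcases Int.units_eq_one_or (((m : ℤ) - 1) * ((l : ℤ) - 1)).negOnePow with h | h <;>
      · simp only [h, Units.val_one, Units.val_neg, one_smul, neg_smul]
        abel

/-- The multiplication of `A`, as an element of `⨁ n, C^n(A)`. -/
def mulCochain : TotalHochschildCochain K A :=
  DirectSum.of (HochschildCochain K A) 2 (MultilinearMap.mkPiAlgebraFin K 2 A)

theorem mulCochain_mem : mulCochain K A ∈ shiftedGrading K (HochschildCochain K A) 1 :=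
  of_mem_shiftedGrading' (by norm_num) _

variable {K A}

/-- The Hochschild differential is the inner derivation `f ↦ -[f, μ]`. -/
theorem of_hochschildDifferential (f : HochschildCochain K A n) :
    DirectSum.of (HochschildCochain K A) (n + 1) (hochschildDifferential K A n f) =
      -bracket K A (DirectSum.of _ n f) (mulCochain K A) := by
  rw [mulCochain, bracket_of_of (N := n + 1) (by omega), ← map_neg]
  congr 1
  -- In `-[f, μ] = -f ∘ μ + (-1)^{n-1} μ ∘ f`, the summands of `μ ∘ f = μ ∘_0 f + (-1)^{n-1} μ ∘_1
  -- f` are the two outer terms of the differential, with signs `(-1)^{n-1}` and `1`.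
  simp only [hochschildDifferential, HochschildCochain.bracket, HochschildCochain.comp,
    LinearMap.coe_mk, AddHom.coe_mk, Fin.sum_univ_two]
  have h1 : ∀ (k : ℕ) (w : HochschildCochain K A (n + 1)),
      (-1 : K) ^ k • w = (k : ℤ).negOnePow • w := by
    intro k w
    rw [Units.smul_def, ← Int.cast_smul_eq_zsmul K, Int.cast_negOnePow_natCast]
  have h2 : ((n : ℤ) - 1).negOnePow = (n + 1 : ℤ).negOnePow := by
    rw [Int.negOnePow_eq_iff]
    exact ⟨-1, by ring⟩
  simp only [h1]
  simp [h2, smul_smul, smul_add, Int.negOnePow_succ]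
  abel

end TotalHochschildCochain

end TotalCochains

/-! ### Transfer of graded Lie algebra structures -/

section Transfer

variable {K L L' : Type*} [Field K] [AddCommGroup L] [Module K L] [AddCommGroup L'] [Module K L']
  {𝓛 : ℤ → Submodule K L} {B : L →ₗ[K] L →ₗ[K] L}
  {𝓛' : ℤ → Submodule K L'} {B' : L' →ₗ[K] L' →ₗ[K] L'}

theorem IsGradedCommutator.isGradedLieAlgebra {circ : L →ₗ[K] L →ₗ[K] L}
    (hb : IsGradedCommutator 𝓛 circ B) (hc : IsGradedPreLie 𝓛 circ)
    (hi : DirectSum.IsInternal 𝓛) : IsGradedLieAlgebra 𝓛 B where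
  isInternal := hi
  bracket_mem := hb.bracket_mem hc
  antisymm := hb.antisymm
  jacobi := hb.jacobi hc
  bracket_self := hb.bracket_self
  bracket_bracket_self := hb.bracket_bracket_self hc

theorem LinearMap.map_intUnits_smul (φ : L →ₗ[K] L') (s : ℤˣ) (x : L) : φ (s • x) = s • φ x := by
  rw [Units.smul_def, Units.smul_def, map_zsmul]

theorem IsGradedLieAlgebra.of_injective (h : IsGradedLieAlgebra 𝓛' B')
    (hi : DirectSum.IsInternal 𝓛) (φ : L →ₗ[K] L') (hφ : Function.Injective φ)
    (hmem : ∀ k x, φ x ∈ 𝓛' k ↔ x ∈ 𝓛 k) (hB : ∀ x y, φ (B x y) = B' (φ x) (φ y)) :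
    IsGradedLieAlgebra 𝓛 B where
  isInternal := hi
  bracket_mem hx hy := by
    rw [← hmem, hB]
    exact h.bracket_mem ((hmem _ _).2 hx) ((hmem _ _).2 hy)
  antisymm hx hy := by
    apply hφ
    rw [map_neg, φ.map_intUnits_smul, hB, hB]
    exact h.antisymm ((hmem _ _).2 hx) ((hmem _ _).2 hy)
  jacobi hx hy hz := by
    apply hφ
    rw [map_add, φ.map_intUnits_smul, hB, hB, hB, hB, hB, hB]
    exact h.jacobi ((hmem _ _).2 hx) ((hmem _ _).2 hy) ((hmem _ _).2 hz)
  bracket_self hi hx := by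
    apply hφ
    rw [hB, map_zero]
    exact h.bracket_self hi ((hmem _ _).2 hx)
  bracket_bracket_self hi hx := by
    apply hφ
    rw [hB, hB, map_zero]
    exact h.bracket_bracket_self hi ((hmem _ _).2 hx)

/-- The axioms are known only for homogeneous elements, so surjectivity is needed in each degree. -/
theorem IsGradedLieAlgebra.of_surjective (h : IsGradedLieAlgebra 𝓛 B)
    (hi : DirectSum.IsInternal 𝓛') (φ : L →ₗ[K] L')
    (hmem : ∀ k x, x ∈ 𝓛 k → φ x ∈ 𝓛' k) (hlift : ∀ k y, y ∈ 𝓛' k → ∃ x ∈ 𝓛 k, φ x = y)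
    (hB : ∀ x y, B' (φ x) (φ y) = φ (B x y)) :
    IsGradedLieAlgebra 𝓛' B' where
  isInternal := hi
  bracket_mem hx hy := by
    obtain ⟨x, hx₀, rfl⟩ := hlift _ _ hx
    obtain ⟨y, hy₀, rfl⟩ := hlift _ _ hy
    rw [hB]
    exact hmem _ _ (h.bracket_mem hx₀ hy₀)
  antisymm hx hy := by
    obtain ⟨x, hx₀, rfl⟩ := hlift _ _ hx
    obtain ⟨y, hy₀, rfl⟩ := hlift _ _ hy
    rw [hB, hB, h.antisymm hx₀ hy₀, map_neg, φ.map_intUnits_smul]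
  jacobi hx hy hz := by
    obtain ⟨x, hx₀, rfl⟩ := hlift _ _ hx
    obtain ⟨y, hy₀, rfl⟩ := hlift _ _ hy
    obtain ⟨z, hz₀, rfl⟩ := hlift _ _ hz
    rw [hB, hB, hB, hB, hB, hB, h.jacobi hx₀ hy₀ hz₀, map_add, φ.map_intUnits_smul]
  bracket_self hi hx := by
    obtain ⟨x, hx₀, rfl⟩ := hlift _ _ hx
    rw [hB, h.bracket_self hi hx₀, map_zero]
  bracket_bracket_self hi hx := by
    obtain ⟨x, hx₀, rfl⟩ := hlift _ _ hx
    rw [hB, hB, h.bracket_bracket_self hi hx₀, map_zero]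

/-- A bilinear map that vanishes on the kernel of a surjection `q` in each variable factors
through `q`. -/
theorem LinearMap.exists_bilinear_factor {P : Type*} [AddCommGroup P] [Module K P]
    (q : L →ₗ[K] L') (hq : Function.Surjective q) (b : L →ₗ[K] L →ₗ[K] P)
    (h₁ : ∀ x y, q x = 0 → b x y = 0) (h₂ : ∀ x y, q y = 0 → b x y = 0) :
    ∃ b' : L' →ₗ[K] L' →ₗ[K] P, ∀ x y, b' (q x) (q y) = b x y := by
  -- Over a field `q` has a linear section `s`; the two vanishing hypotheses make `b (s ·) (s ·)`
  -- the required factorisation.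
  obtain ⟨s, hs⟩ := q.exists_rightInverse_of_surjective (LinearMap.range_eq_top.2 hq)
  have hk : ∀ x, q (s (q x) - x) = 0 := fun x => by
    rw [map_sub, ← LinearMap.comp_apply, hs, LinearMap.id_apply, sub_self]
  refine ⟨b.compl₁₂ s s, fun x y => ?_⟩
  have e₁ := h₁ _ (s (q y)) (hk x)
  have e₂ := h₂ x _ (hk y)
  rw [map_sub, LinearMap.sub_apply, sub_eq_zero] at e₁
  rw [map_sub, sub_eq_zero] at e₂
  rw [LinearMap.compl₁₂_apply, e₁, e₂]

variable {M M' : ℕ → Type*} [∀ n, AddCommGroup (M n)] [∀ n, Module K (M n)]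
  [∀ n, AddCommGroup (M' n)] [∀ n, Module K (M' n)]

theorem lmap_mem_shiftedGrading (φ : ∀ n, M n →ₗ[K] M' n) {k : ℤ} {x : ⨁ n, M n}
    (hx : x ∈ shiftedGrading K M k) : DirectSum.lmap φ x ∈ shiftedGrading K M' k := by
  intro n hn
  rw [DirectSum.lmap_apply, hx n hn, map_zero]

theorem lmap_mem_shiftedGrading_iff (φ : ∀ n, M n →ₗ[K] M' n)
    (hφ : ∀ n, Function.Injective (φ n)) (k : ℤ) (x : ⨁ n, M n) :
    DirectSum.lmap φ x ∈ shiftedGrading K M' k ↔ x ∈ shiftedGrading K M k := by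
  refine ⟨fun hx n hn => ?_, lmap_mem_shiftedGrading φ⟩
  have := hx n hn
  rwa [DirectSum.lmap_apply, map_eq_zero_iff _ (hφ n)] at this

theorem exists_lmap_eq_of_mem_shiftedGrading (φ : ∀ n, M n →ₗ[K] M' n)
    (hφ : ∀ n, Function.Surjective (φ n)) (k : ℤ) (y : ⨁ n, M' n)
    (hy : y ∈ shiftedGrading K M' k) : ∃ x ∈ shiftedGrading K M k, DirectSum.lmap φ x = y := by
  obtain rfl | ⟨n, a, rfl, rfl⟩ := eq_zero_or_exists_of_mem_shiftedGrading hy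
  · exact ⟨0, zero_mem _, map_zero _⟩
  · obtain ⟨a, rfl⟩ := hφ n a
    exact ⟨_, of_mem_shiftedGrading a, DirectSum.lmap_lof φ n a⟩

end Transfer

/-! ### The Gerstenhaber bracket on Hochschild cohomology -/

section HochschildBracket

variable {K : Type*} [Field K] {A : Type*} [Ring A] [Algebra K A] {n m N : ℕ}

open TotalHochschildCochain

theorem bracket_mulCochain_eq_zero {f : HochschildCochain K A n}
    (hf : f ∈ hochschildCocycles K A n) :
    bracket K A (DirectSum.of _ n f) (mulCochain K A) = 0 := by
  have h := of_hochschildDifferential f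
  rwa [LinearMap.mem_ker.1 hf, map_zero, eq_comm, neg_eq_zero] at h

/-- The derivation rule `δ[f, g] = [f, δg] ± [δf, g]`. -/
theorem HochschildCochain.bracket_mem_cocycles (h : N + 1 = n + m) {f : HochschildCochain K A n}
    {g : HochschildCochain K A m} (hf : f ∈ hochschildCocycles K A n)
    (hg : g ∈ hochschildCocycles K A m) : f.bracket h g ∈ hochschildCocycles K A N := by
  apply DirectSum.of_injective (β := HochschildCochain K A) (N + 1)
  rw [of_hochschildDifferential, ← bracket_of_of h,
    (isGradedCommutator K A).neg_bracket_bracket (isGradedPreLie K A) (of_mem_shiftedGrading f)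
      (of_mem_shiftedGrading g) (mulCochain_mem K A),
    bracket_mulCochain_eq_zero hf, bracket_mulCochain_eq_zero hg]
  simp

theorem HochschildCochain.bracket_antisymm (h : N + 1 = n + m) (f : HochschildCochain K A n)
    (g : HochschildCochain K A m) :
    f.bracket h g = -((((n : ℤ) - 1) * ((m : ℤ) - 1)).negOnePow •
      g.bracket (h.trans (add_comm n m)) f) := by
  apply DirectSum.of_injective (β := HochschildCochain K A) N
  rw [map_neg, Units.smul_def, map_zsmul, ← Units.smul_def, ← bracket_of_of, ← bracket_of_of]
  exact (isGradedCommutator K A).antisymm (of_mem_shiftedGrading f) (of_mem_shiftedGrading g)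

theorem intUnits_smul_mem_iff {V : Type*} [AddCommGroup V] [Module K V] (S : Submodule K V)
    (s : ℤˣ) (x : V) : s • x ∈ S ↔ x ∈ S := by
  rcases Int.units_eq_one_or s with rfl | rfl <;> simp

/-- If `δg = 0`, the derivation rule reads `[δw, g] = ± δ[w, g]`. -/
theorem HochschildCochain.bracket_mem_coboundaries_left (h : N + 1 = n + m)
    {f : HochschildCochain K A n} {g : HochschildCochain K A m}
    (hf : f ∈ hochschildCoboundaries K A n) (hg : g ∈ hochschildCocycles K A m) :
    f.bracket h g ∈ hochschildCoboundaries K A N := by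
  obtain rfl | n := n
  · obtain rfl : f = 0 := hf
    rw [show HochschildCochain.bracket h 0 g = 0 from
      DirectSum.of_injective (β := HochschildCochain K A) N (by rw [← bracket_of_of h]; simp)]
    exact zero_mem _
  obtain ⟨w, rfl⟩ := hf
  have key := (isGradedCommutator K A).neg_bracket_bracket (isGradedPreLie K A)
    (of_mem_shiftedGrading w) (of_mem_shiftedGrading g) (mulCochain_mem K A)
  rw [bracket_mulCochain_eq_zero hg, ← of_hochschildDifferential, bracket_of_of h, neg_zero,
    map_zero, zero_add, Units.smul_def, ← map_zsmul, ← Units.smul_def] at key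
  rw [← intUnits_smul_mem_iff _ ((m : ℤ) - 1).negOnePow]
  -- For `N = 0` both `w` and `g` lie in `C^0`, so `[w, g] = 0`, and hence `[δw, g] = 0`, as there
  -- are no nonzero coboundaries in `C^0`.
  obtain rfl | N := N
  · obtain rfl : n = 0 := by omega
    obtain rfl : m = 0 := by omega
    rw [bracket_of_zero_of_zero, map_zero, LinearMap.zero_apply, neg_zero] at key
    exact (DirectSum.of_injective (β := HochschildCochain K A) 0 (key.symm.trans (map_zero _).symm))
  · rw [bracket_of_of (N := N) (by omega), ← of_hochschildDifferential] at key
    exact ⟨_, DirectSum.of_injective (β := HochschildCochain K A) (N + 1) key⟩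

theorem HochschildCochain.bracket_mem_coboundaries_right (h : N + 1 = n + m)
    {f : HochschildCochain K A n} {g : HochschildCochain K A m}
    (hf : f ∈ hochschildCocycles K A n) (hg : g ∈ hochschildCoboundaries K A m) :
    f.bracket h g ∈ hochschildCoboundaries K A N := by
  rw [bracket_antisymm, neg_mem_iff, intUnits_smul_mem_iff]
  exact bracket_mem_coboundaries_left _ hg hf

variable (K A) in
/-- The Gerstenhaber bracket of cochains as a bilinear map. -/
def HochschildCochain.bracketₗ (h : N + 1 = n + m) :
    HochschildCochain K A n →ₗ[K] HochschildCochain K A m →ₗ[K] HochschildCochain K A N :=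
  compₗ K A h - (((n : ℤ) - 1) * ((m : ℤ) - 1)).negOnePow •
    (compₗ K A (h.trans (add_comm n m))).flip

variable (K A)

/-- The direct sum of the spaces of Hochschild cocycles. -/
abbrev TotalHochschildCocycle : Type _ := ⨁ n, hochschildCocycles K A n

namespace TotalHochschildCocycle

/-- The inclusion of cocycles in cochains. -/
def toCochain : TotalHochschildCocycle K A →ₗ[K] TotalHochschildCochain K A :=
  DirectSum.lmap fun n => (hochschildCocycles K A n).subtype

/-- The projection of cocycles to cohomology. -/
def toCohomology : TotalHochschildCocycle K A →ₗ[K] TotalHochschildCohomology K A :=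
  DirectSum.lmap fun n => ((hochschildCoboundaries K A n).submoduleOf
    (hochschildCocycles K A n)).mkQ

/-- The Gerstenhaber bracket of cocycles. -/
def bracket : TotalHochschildCocycle K A →ₗ[K] TotalHochschildCocycle K A →ₗ[K]
    TotalHochschildCocycle K A :=
  DirectSum.bilinear fun n m =>
    if h : n + m - 1 + 1 = n + m then
      LinearMap.mk₂ K (fun f g => DirectSum.lof K ℕ (fun n => hochschildCocycles K A n) (n + m - 1)
          ⟨f.1.bracket h g.1, HochschildCochain.bracket_mem_cocycles h f.2 g.2⟩)
        (fun f f' g => by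
          rw [← map_add]
          congr 1
          exact Subtype.ext (LinearMap.map_add₂ (HochschildCochain.bracketₗ K A h) f.1 f'.1 g.1))
        (fun c f g => by
          rw [← map_smul]
          congr 1
          exact Subtype.ext (LinearMap.map_smul₂ (HochschildCochain.bracketₗ K A h) c f.1 g.1))
        (fun f g g' => by
          rw [← map_add]
          congr 1
          exact Subtype.ext (map_add (HochschildCochain.bracketₗ K A h f.1) g.1 g'.1))
        (fun c f g => by
          rw [← map_smul]
          congr 1
          exact Subtype.ext (map_smul (HochschildCochain.bracketₗ K A h f.1) c g.1))
    else 0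

/-- The class of the Gerstenhaber bracket of two cocycles. -/
def bracketClass : TotalHochschildCocycle K A →ₗ[K] TotalHochschildCocycle K A →ₗ[K]
    TotalHochschildCohomology K A :=
  LinearMap.mk₂ K (fun x y => toCohomology K A (bracket K A x y))
    (fun x x' y => by rw [map_add, LinearMap.add_apply, map_add])
    (fun c x y => by rw [map_smul, LinearMap.smul_apply, map_smul])
    (fun x y y' => by rw [map_add, map_add])
    (fun c x y => by rw [map_smul, map_smul])

variable {K A}

@[simp] theorem bracketClass_apply (x y : TotalHochschildCocycle K A) :
    bracketClass K A x y = toCohomology K A (bracket K A x y) := rfl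

@[simp] theorem toCochain_of (f : hochschildCocycles K A n) :
    toCochain K A (DirectSum.of _ n f) = DirectSum.of _ n (f : HochschildCochain K A n) :=
  DirectSum.lmap_lof _ _ _

@[simp] theorem toCohomology_of (f : hochschildCocycles K A n) :
    toCohomology K A (DirectSum.of _ n f) = hochschildClass f.1 f.2 :=
  DirectSum.lmap_lof _ _ _

theorem bracket_of_of (h : N + 1 = n + m) (f : hochschildCocycles K A n)
    (g : hochschildCocycles K A m) :
    bracket K A (DirectSum.of _ n f) (DirectSum.of _ m g) =
      DirectSum.of (fun n => hochschildCocycles K A n) N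
        ⟨f.1.bracket h g.1, HochschildCochain.bracket_mem_cocycles h f.2 g.2⟩ := by
  obtain rfl : N = n + m - 1 := by omega
  rw [bracket, DirectSum.bilinear_of_of, dif_pos h]
  rfl

theorem bracket_of_zero_of_zero (f g : hochschildCocycles K A 0) :
    bracket K A (DirectSum.of _ 0 f) (DirectSum.of _ 0 g) = 0 := by
  rw [bracket, DirectSum.bilinear_of_of, dif_neg (by omega)]
  rfl

theorem toCochain_bracket (x y : TotalHochschildCocycle K A) :
    toCochain K A (bracket K A x y) =
      TotalHochschildCochain.bracket K A (toCochain K A x) (toCochain K A y) := by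
  have : (bracket K A).compr₂ (toCochain K A) =
      (TotalHochschildCochain.bracket K A).compl₁₂ (toCochain K A) (toCochain K A) := by
    refine DirectSum.bilinear_ext fun n m f g => ?_
    simp only [LinearMap.compr₂_apply, LinearMap.compl₁₂_apply, toCochain_of]
    by_cases h : n + m = 0
    · obtain rfl : n = 0 := by omega
      obtain rfl : m = 0 := by omega
      rw [bracket_of_zero_of_zero, TotalHochschildCochain.bracket_of_zero_of_zero, map_zero]
    · have h' : n + m - 1 + 1 = n + m := by omega
      rw [bracket_of_of h', TotalHochschildCochain.bracket_of_of h', toCochain_of]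
  exact LinearMap.congr_fun₂ this x y

variable (K A)

theorem isGradedLieAlgebra :
    IsGradedLieAlgebra (shiftedGrading K fun n => hochschildCocycles K A n) (bracket K A) :=
  ((isGradedCommutator K A).isGradedLieAlgebra (isGradedPreLie K A)
    isInternal_shiftedGrading).of_injective isInternal_shiftedGrading (toCochain K A)
    ((DirectSum.lmap_injective _).2 fun _ => Subtype.val_injective)
    (lmap_mem_shiftedGrading_iff _ fun _ => Subtype.val_injective) toCochain_bracket

theorem toCohomology_surjective : Function.Surjective (toCohomology K A) :=
  (DirectSum.lmap_surjective _).2 fun _ => Submodule.mkQ_surjective _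

variable {K A}

theorem hochschildClass_eq_zero {f : HochschildCochain K A n} (hf : f ∈ hochschildCocycles K A n)
    (hf' : f ∈ hochschildCoboundaries K A n) : hochschildClass f hf = 0 := by
  rw [hochschildClass, (Submodule.Quotient.mk_eq_zero _).2, map_zero]
  exact hf'

theorem apply_mem_coboundaries {x : TotalHochschildCocycle K A}
    (hx : toCohomology K A x = 0) (n : ℕ) :
    (x n : HochschildCochain K A n) ∈ hochschildCoboundaries K A n := by
  have h : toCohomology K A x n = 0 := by rw [hx]; rfl
  rw [toCohomology, DirectSum.lmap_apply, Submodule.mkQ_apply,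
    Submodule.Quotient.mk_eq_zero] at h
  exact h

theorem toCohomology_bracket_of_of (f : hochschildCocycles K A n) (g : hochschildCocycles K A m)
    (hfg : f.1 ∈ hochschildCoboundaries K A n ∨ g.1 ∈ hochschildCoboundaries K A m) :
    toCohomology K A (bracket K A (DirectSum.of _ n f) (DirectSum.of _ m g)) = 0 := by
  by_cases h : n + m = 0
  · obtain rfl : n = 0 := by omega
    obtain rfl : m = 0 := by omega
    rw [bracket_of_zero_of_zero, map_zero]
  · have h' : n + m - 1 + 1 = n + m := by omega
    rw [bracket_of_of h', toCohomology_of]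
    refine hochschildClass_eq_zero _ (hfg.elim (fun hf => ?_) fun hg => ?_)
    · exact HochschildCochain.bracket_mem_coboundaries_left h' hf g.2
    · exact HochschildCochain.bracket_mem_coboundaries_right h' f.2 hg

/-- With its mirror image, this says that the kernel of `toCohomology` is an ideal of the Lie
algebra of cocycles. -/
theorem toCohomology_bracket_left {x : TotalHochschildCocycle K A}
    (hx : toCohomology K A x = 0) (y : TotalHochschildCocycle K A) :
    toCohomology K A (bracket K A x y) = 0 := by
  classical
  induction y using DirectSum.induction_on with
  | zero => simp
  | add y z hy hz => rw [map_add, map_add, hy, hz, add_zero]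
  | of m g =>
    rw [← DirectSum.sum_support_of x, map_sum, LinearMap.sum_apply, map_sum]
    exact Finset.sum_eq_zero fun n _ =>
      toCohomology_bracket_of_of _ _ (Or.inl (apply_mem_coboundaries hx n))

theorem toCohomology_bracket_right (x : TotalHochschildCocycle K A) {y : TotalHochschildCocycle K A}
    (hy : toCohomology K A y = 0) :
    toCohomology K A (bracket K A x y) = 0 := by
  classical
  induction x using DirectSum.induction_on with
  | zero => simp
  | add x z hx hz => rw [map_add, LinearMap.add_apply, map_add, hx, hz, add_zero]
  | of n f =>
    rw [← DirectSum.sum_support_of y, map_sum, map_sum]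
    exact Finset.sum_eq_zero fun n _ =>
      toCohomology_bracket_of_of _ _ (Or.inr (apply_mem_coboundaries hy n))

end TotalHochschildCocycle

open TotalHochschildCocycle

theorem exists_apply_toCohomology_eq :
    ∃ B : TotalHochschildCohomology K A →ₗ[K] TotalHochschildCohomology K A →ₗ[K]
      TotalHochschildCohomology K A, ∀ x y, B (toCohomology K A x) (toCohomology K A y) =
        toCohomology K A (TotalHochschildCocycle.bracket K A x y) :=
  LinearMap.exists_bilinear_factor (L := TotalHochschildCocycle K A)
    (L' := TotalHochschildCohomology K A) (P := TotalHochschildCohomology K A) (toCohomology K A)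
    (toCohomology_surjective K A) (bracketClass K A)
    (fun _ y hx => toCohomology_bracket_left hx y) (fun x _ hy => toCohomology_bracket_right x hy)

theorem exists_isGerstenhaberBracket :
    ∃ B : TotalHochschildCohomology K A →ₗ[K] TotalHochschildCohomology K A →ₗ[K]
      TotalHochschildCohomology K A, IsGerstenhaberBracket B := by
  obtain ⟨B, hB⟩ := exists_apply_toCohomology_eq K A
  refine ⟨B, fun f g hf hg => ?_, fun {n m N} h f g hf hg =>
    ⟨HochschildCochain.bracket_mem_cocycles h hf hg, ?_⟩⟩
  · have := hB (DirectSum.of _ 0 ⟨f, hf⟩) (DirectSum.of _ 0 ⟨g, hg⟩)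
    rwa [toCohomology_of, toCohomology_of,
      TotalHochschildCocycle.bracket_of_zero_of_zero, map_zero] at this
  · have := hB (DirectSum.of _ n ⟨f, hf⟩) (DirectSum.of _ m ⟨g, hg⟩)
    rwa [toCohomology_of, toCohomology_of,
      TotalHochschildCocycle.bracket_of_of h, toCohomology_of] at this

variable {K A}

variable {B : TotalHochschildCohomology K A →ₗ[K] TotalHochschildCohomology K A →ₗ[K]
      TotalHochschildCohomology K A}

/-- The specification concerns single classes only; bilinearity extends it to all sums of cocycles.
Uniqueness and the Lie axioms then follow from surjectivity of `toCohomology`. -/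
theorem IsGerstenhaberBracket.apply_toCohomology (hB : IsGerstenhaberBracket B)
    (x y : TotalHochschildCocycle K A) :
    B (toCohomology K A x) (toCohomology K A y) =
      toCohomology K A (TotalHochschildCocycle.bracket K A x y) := by
  have : B.compl₁₂ (toCohomology K A) (toCohomology K A) = bracketClass K A := by
    refine DirectSum.bilinear_ext (P := TotalHochschildCohomology K A) fun n m f g => ?_
    simp only [bracketClass_apply, LinearMap.compl₁₂_apply, toCohomology_of]
    by_cases h : n + m = 0
    · obtain rfl : n = 0 := by omega
      obtain rfl : m = 0 := by omega
      rw [TotalHochschildCocycle.bracket_of_zero_of_zero, hB.zero_zero, map_zero]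
    · have h' : n + m - 1 + 1 = n + m := by omega
      obtain ⟨_, e⟩ := hB.bracket_class h' f.1 g.1 f.2 g.2
      rw [TotalHochschildCocycle.bracket_of_of h', e, toCohomology_of]
  exact LinearMap.congr_fun₂ this x y

theorem IsGerstenhaberBracket.unique {B' : TotalHochschildCohomology K A →ₗ[K]
      TotalHochschildCohomology K A →ₗ[K] TotalHochschildCohomology K A}
    (hB : IsGerstenhaberBracket B) (hB' : IsGerstenhaberBracket B') : B = B' := by
  refine LinearMap.ext₂ fun x y => ?_
  obtain ⟨x, rfl⟩ := toCohomology_surjective K A x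
  obtain ⟨y, rfl⟩ := toCohomology_surjective K A y
  rw [hB.apply_toCohomology, hB'.apply_toCohomology]

theorem IsGerstenhaberBracket.isGradedLieAlgebra (hB : IsGerstenhaberBracket B) :
    IsGradedLieAlgebra (shiftedGrading K (HochschildCohomology K A)) B :=
  (TotalHochschildCocycle.isGradedLieAlgebra K A).of_surjective isInternal_shiftedGrading
    (toCohomology K A) (fun _ _ hx => lmap_mem_shiftedGrading _ hx)
    (exists_lmap_eq_of_mem_shiftedGrading _ fun _ => Submodule.mkQ_surjective _)
    hB.apply_toCohomology

end HochschildBracket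

/-! ### Group cohomology with trivial coefficients as cocycles modulo coboundaries -/

section GroupCohomology

variable (K G : Type u) [Field K] [CommGroup G] {n : ℕ}

open CategoryTheory

/-- The differential of inhomogeneous cochains with trivial coefficients. -/
noncomputable def groupDifferential (n : ℕ) : ((Fin n → G) → K) →ₗ[K] ((Fin (n + 1) → G) → K) :=
  (inhomogeneousCochains.d (Rep.trivial K G K) n).hom

/-- Inhomogeneous cocycles with trivial coefficients. -/
noncomputable def groupCocycles (n : ℕ) : Submodule K ((Fin n → G) → K) :=
  LinearMap.ker (groupDifferential K G n)

variable {K G}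

theorem groupDifferential_apply (α : (Fin n → G) → K) (x : Fin (n + 1) → G) :
    groupDifferential K G n α x = α (fun j => x j.succ) +
      ∑ j : Fin (n + 1), (-1 : K) ^ ((j : ℕ) + 1) * α (Fin.contractNth j (· * ·) x) := by
  exact inhomogeneousCochains.d_hom_apply _ _ _ _

theorem mem_groupCocycles {α : (Fin n → G) → K} : α ∈ groupCocycles K G n ↔ IsGroupCocycle α :=
  Iff.rfl

theorem iCocycles_injective :
    Function.Injective (groupCohomology.iCocycles (Rep.trivial K G K) n) :=
  (ModuleCat.mono_iff_injective _).1 inferInstance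

variable (K G n) in
/-- The cohomology class of a cocycle, as a linear map. -/
noncomputable def groupClass : groupCocycles K G n →ₗ[K] groupCohomology (Rep.trivial K G K) n :=
  (groupCohomology.π (Rep.trivial K G K) n).hom ∘ₗ
    { toFun := fun α => groupCohomology.cocyclesMk (A := Rep.trivial K G K) α.1 α.2
      map_add' := fun α β => by
        apply iCocycles_injective
        rw [map_add, groupCohomology.iCocycles_mk, groupCohomology.iCocycles_mk,
          groupCohomology.iCocycles_mk]
        exacts [rfl, β.2, α.2, (α + β).2]
      map_smul' := fun c α => by
        apply iCocycles_injective
        rw [RingHom.id_apply, map_smul, groupCohomology.iCocycles_mk, groupCohomology.iCocycles_mk]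
        exacts [rfl, α.2, (c • α).2] }

theorem groupClass_apply (α : groupCocycles K G n) : groupClass K G n α =
    groupCohomology.π (Rep.trivial K G K) n (groupCohomology.cocyclesMk α.1 α.2) := rfl

theorem exists_cocyclesMk_eq (z : groupCohomology.cocycles (Rep.trivial K G K) n) :
    ∃ α : groupCocycles K G n,
      groupCohomology.cocyclesMk (A := Rep.trivial K G K) α.1 α.2 = z := by
  refine ⟨⟨groupCohomology.iCocycles (Rep.trivial K G K) n z, ?_⟩, ?_⟩
  · change inhomogeneousCochains.d (Rep.trivial K G K) n
      (groupCohomology.iCocycles (Rep.trivial K G K) n z) = 0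
    rw [← groupCohomology.inhomogeneousCochains.d_def]
    have := (groupCohomology.inhomogeneousCochains (Rep.trivial K G K)).iCycles_d n (n + 1)
    exact ConcreteCategory.congr_hom this z
  · apply iCocycles_injective
    exact groupCohomology.iCocycles_mk (A := Rep.trivial K G K) _ _

theorem groupClass_surjective : Function.Surjective (groupClass K G n) := by
  intro x
  induction x using groupCohomology_induction_on with
  | h z =>
    obtain ⟨α, rfl⟩ := exists_cocyclesMk_eq z
    exact ⟨α, rfl⟩

/-- Homology is the cokernel of the map from cochains to cycles, and a cokernel sequence of modules
is exact. -/
theorem π_eq_zero_iff (i : ℕ) (hi : (ComplexShape.up ℕ).prev n = i)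
    (z : groupCohomology.cocycles (Rep.trivial K G K) n) :
    groupCohomology.π (Rep.trivial K G K) n z = 0 ↔
      ∃ w, groupCohomology.toCocycles (Rep.trivial K G K) i n w = z := by
  have h := ShortComplex.exact_of_g_is_cokernel (ShortComplex.mk _ _
    ((groupCohomology.inhomogeneousCochains (Rep.trivial K G K)).toCycles_comp_homologyπ i n))
    ((groupCohomology.inhomogeneousCochains (Rep.trivial K G K)).homologyIsCokernel i n hi)
  refine ⟨fun hz => (ShortComplex.moduleCat_exact_iff _).1 h z hz, ?_⟩
  rintro ⟨w, rfl⟩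
  exact ConcreteCategory.congr_hom
    ((groupCohomology.inhomogeneousCochains (Rep.trivial K G K)).toCycles_comp_homologyπ i n) w

theorem groupClass_zero_eq_zero_iff (α : groupCocycles K G 0) :
    groupClass K G 0 α = 0 ↔ α = 0 := by
  refine ⟨fun h => ?_, fun h => by rw [h, map_zero]⟩
  rw [groupClass_apply, π_eq_zero_iff 0 (by simp)] at h
  obtain ⟨w, hw⟩ := h
  -- Degree `0` has no predecessor, so `prev 0` takes the default value `0`, and the corresponding
  -- map into cocycles is zero.
  have h0 : groupCohomology.toCocycles (Rep.trivial K G K) 0 0 = 0 :=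
    HomologicalComplex.toCycles_eq_zero _ (by simp)
  rw [h0] at hw
  have h1 := congrArg (groupCohomology.iCocycles (Rep.trivial K G K) 0) hw
  rw [groupCohomology.iCocycles_mk (A := Rep.trivial K G K) α.1 α.2] at h1
  exact Subtype.ext (h1.symm.trans (map_zero _))

theorem groupClass_succ_eq_zero_iff (α : groupCocycles K G (n + 1)) :
    groupClass K G (n + 1) α = 0 ↔ ∃ β, groupDifferential K G n β = α := by
  rw [groupClass_apply, π_eq_zero_iff n (by simp)]
  have key : ∀ w, groupCohomology.iCocycles (Rep.trivial K G K) (n + 1)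
      (groupCohomology.toCocycles (Rep.trivial K G K) n (n + 1) w) = groupDifferential K G n w := by
    intro w
    have := (groupCohomology.inhomogeneousCochains (Rep.trivial K G K)).toCycles_i n (n + 1)
    rw [groupCohomology.inhomogeneousCochains.d_def] at this
    exact ConcreteCategory.congr_hom this w
  constructor
  · rintro ⟨w, hw⟩
    refine ⟨w, ?_⟩
    rw [← key, hw]
    exact groupCohomology.iCocycles_mk (A := Rep.trivial K G K) _ _
  · rintro ⟨w, hw⟩
    refine ⟨w, ?_⟩
    apply iCocycles_injective
    rw [key, hw]
    exact (groupCohomology.iCocycles_mk (A := Rep.trivial K G K) _ _).symm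

end GroupCohomology

/-! ### Hochschild cochains of a group algebra -/

section Substitution

variable {X Y : Type*} {n m N : ℕ}

theorem comp_substAt (φ : X → Y) (h : N + 1 = n + m) (i : Fin n) (x : Fin N → X) (a : X) :
    (fun j => φ (substAt h i x a j)) = substAt h i (fun j => φ (x j)) (φ a) := by
  funext j
  simp only [substAt]
  split_ifs <;> rfl

theorem comp_blockAt (φ : X → Y) (h : N + 1 = n + m) (i : Fin n) (x : Fin N → X) :
    (fun j => φ (blockAt h i x j)) = blockAt h i (fun j => φ (x j)) := rfl

theorem contractNth_castSucc_eq_substAt [Mul X] (i : Fin n) (x : Fin (n + 1) → X) :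
    Fin.contractNth i.castSucc (· * ·) x =
      substAt (by omega : n + 1 + 1 = n + 2) i x (x i.castSucc * x i.succ) := by
  funext j
  simp only [substAt, Fin.contractNth, Fin.val_castSucc]
  split_ifs with h₁ h₂
  · rfl
  · obtain rfl : j = i := Fin.ext h₂
    rfl
  · rfl

theorem contractNth_last [Mul X] (x : Fin (n + 1) → X) :
    Fin.contractNth (Fin.last n) (· * ·) x = fun j => x j.castSucc := by
  funext j
  rw [Fin.contractNth_apply_of_lt _ _ _ _ (by simp)]

/-- Replacing a block by its product leaves the total product unchanged, and commutativity moves the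
extra factor `y` to the end. -/
theorem prod_substAt [CommMonoid X] (h : N + 1 = n + m) (i : Fin n) (x : Fin N → X) (y : X) :
    ∏ j, substAt h i x ((∏ k, blockAt h i x k) * y) j = (∏ j, x j) * y := by
  -- Extending `x` by `1` to `ℕ` turns both sides into products over ranges, which split as `i + (m
  -- + r)` and `i + (1 + r)`.
  let X' : ℕ → X := fun k => if hk : k < N then x ⟨k, hk⟩ else 1
  have hX : ∀ k (hk : k < N), x ⟨k, hk⟩ = X' k := fun k hk => by simp [X', hk]
  have hx : ∏ j, x j = ∏ j ∈ Finset.range N, X' j := by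
    rw [← Fin.prod_univ_eq_prod_range]
    exact Finset.prod_congr rfl fun j _ => hX j j.2
  have hb : ∏ k, blockAt h i x k = ∏ k ∈ Finset.range m, X' (i + k) := by
    rw [← Fin.prod_univ_eq_prod_range (fun k => X' (i + k))]
    exact Finset.prod_congr rfl fun k _ => hX _ _
  obtain ⟨i, hi⟩ := i
  obtain ⟨r, rfl⟩ : ∃ r, n = i + (1 + r) := ⟨n - i - 1, by omega⟩
  obtain rfl : N = i + (m + r) := by omega
  rw [hb, hx]
  set a := (∏ k ∈ Finset.range m, X' (i + k)) * y with ha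
  have hs : ∀ j : Fin (i + (1 + r)), substAt h ⟨i, hi⟩ x a j =
      (fun j : ℕ => if j < i then X' j else if j = i then a else X' (j + m - 1)) j := by
    intro j
    simp only [substAt, hX]
    split_ifs <;> rfl
  rw [Finset.prod_congr rfl fun j _ => hs j, Fin.prod_univ_eq_prod_range
    (fun j : ℕ => if j < i then X' j else if j = i then a else X' (j + m - 1)),
    Finset.prod_range_add, Finset.prod_range_add, Finset.prod_range_add, Finset.prod_range_add]
  have h₁ : ∏ j ∈ Finset.range i, (if j < i then X' j else if j = i then a else X' (j + m - 1)) =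
      ∏ j ∈ Finset.range i, X' j :=
    Finset.prod_congr rfl fun j hj => if_pos (Finset.mem_range.1 hj)
  have h₂ : ∏ j ∈ Finset.range r, (if i + (1 + j) < i then X' (i + (1 + j)) else
      if i + (1 + j) = i then a else X' (i + (1 + j) + m - 1)) =
      ∏ j ∈ Finset.range r, X' (i + (m + j)) := by
    refine Finset.prod_congr rfl fun j _ => ?_
    rw [if_neg (by omega), if_neg (by omega)]
    congr 1
    omega
  rw [h₁, h₂, Finset.prod_range_one, if_neg (by omega), if_pos (by omega), ha]
  simp only [mul_assoc, mul_comm y]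

end Substitution

/-! ### Cochains of `KG` in coordinates with respect to `G` -/

section GroupAlgebra

variable {K G : Type*} [Field K] [CommGroup G] {n m N : ℕ}

theorem HochschildCochain.ext_single {f g : HochschildCochain K (MonoidAlgebra K G) n}
    (h : ∀ x : Fin n → G, f (fun i => MonoidAlgebra.single (x i) 1) =
      g (fun i => MonoidAlgebra.single (x i) 1)) : f = g := by
  refine Module.Basis.ext_multilinear (fun _ => MonoidAlgebra.basis G K) fun x => ?_
  simpa using h x

/-- The coefficient of `x₁ ⋯ xₙ y` in `f(x₁, …, xₙ)`. -/
noncomputable def coeffCochain (n : ℕ) (y : G) :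
    HochschildCochain K (MonoidAlgebra K G) n →ₗ[K] ((Fin n → G) → K) where
  toFun f x := (f fun i => MonoidAlgebra.single (x i) 1).coeff ((∏ i, x i) * y)
  map_add' _ _ := rfl
  map_smul' _ _ := rfl

theorem coeffCochain_apply (y : G) (f : HochschildCochain K (MonoidAlgebra K G) n)
    (x : Fin n → G) : coeffCochain n y f x =
      (f fun i => MonoidAlgebra.single (x i) 1).coeff ((∏ i, x i) * y) := rfl

theorem HochschildCochain.ext_coeffCochain {f g : HochschildCochain K (MonoidAlgebra K G) n}
    (h : ∀ y, coeffCochain n y f = coeffCochain n y g) : f = g := by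
  refine HochschildCochain.ext_single fun x => ?_
  refine MonoidAlgebra.coeff_injective (Finsupp.ext fun z => ?_)
  -- This choice of `y` makes `x₁⋯xₙ y` equal to the given `z`.
  have := congrFun (h ((∏ i, x i)⁻¹ * z)) x
  rwa [coeffCochain_apply, coeffCochain_apply, mul_inv_cancel_left] at this

variable [Finite G]

/-- The cochain with `(x₁, …, xₙ) ↦ α(x₁, …, xₙ) x₁ ⋯ xₙ y`, linearly in `α`. -/
noncomputable def monomialCochain (n : ℕ) (y : G) :
    ((Fin n → G) → K) →ₗ[K] HochschildCochain K (MonoidAlgebra K G) n :=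
  letI := Fintype.ofFinite G
  -- The product of the coordinate forms at `x₁, …, xₙ` is `1` on the basis tuple `x` and `0` on
  -- every other one.
  ∑ x : Fin n → G, (LinearMap.proj x).smulRight
    (((MultilinearMap.mkPiAlgebra K (Fin n) K).compLinearMap fun i =>
      (MonoidAlgebra.basis G K).coord (x i)).smulRight
        (MonoidAlgebra.single ((∏ i, x i) * y) (1 : K)))

theorem monomialCochain_apply_single (y : G) (α : (Fin n → G) → K) (x : Fin n → G) :
    monomialCochain n y α (fun i => MonoidAlgebra.single (x i) 1) =
      MonoidAlgebra.single ((∏ i, x i) * y) (α x) := by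
  let := Fintype.ofFinite G
  rw [monomialCochain, LinearMap.sum_apply, sum_apply, Finset.sum_eq_single x]
  · simp [MonoidAlgebra.basis, MonoidAlgebra.smul_single]
  · intro x' _ hx'
    obtain ⟨i, hi⟩ := Function.ne_iff.1 hx'
    have : ∏ j, (MonoidAlgebra.basis G K).repr (MonoidAlgebra.single (x j) (1 : K)) (x' j) = 0 :=
      Finset.prod_eq_zero (Finset.mem_univ i) (by simp [MonoidAlgebra.basis, hi.symm])
    simp [this]
  · simp

/-- Together with `sum_monomialCochain`, this splits `C^n(KG)` into copies of `Map(G^n, K)` indexed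
by `G`. -/
theorem coeffCochain_monomialCochain [DecidableEq G] (y z : G) (α : (Fin n → G) → K) :
    coeffCochain n z (monomialCochain n y α) = if y = z then α else 0 := by
  funext x
  rw [coeffCochain_apply, monomialCochain_apply_single, MonoidAlgebra.coeff_single,
    Finsupp.single_apply]
  simp only [mul_right_inj]
  split_ifs <;> rfl

theorem monomialCochain_injective (y : G) :
    Function.Injective (monomialCochain (K := K) n y) := by
  classical
  intro α β h
  have := congrArg (coeffCochain n y) h
  rwa [coeffCochain_monomialCochain, coeffCochain_monomialCochain, if_pos rfl, if_pos rfl] at this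

theorem sum_monomialCochain [Fintype G] (f : HochschildCochain K (MonoidAlgebra K G) n) :
    ∑ y, monomialCochain n y (coeffCochain n y f) = f := by
  classical
  refine HochschildCochain.ext_coeffCochain fun z => ?_
  rw [map_sum]
  simp [coeffCochain_monomialCochain]

/-- On group elements the inner cochain returns a scalar `β(…)` times a single group element. The
scalar comes out by multilinearity, the outer cochain is evaluated on group elements again, and by
`prod_substAt` the new product is the old one times `y`. -/
theorem compAt_monomialCochain (h : N + 1 = n + m) (i : Fin n) (α : (Fin n → G) → K) (x : G)
    (β : (Fin m → G) → K) (y : G) :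
    (monomialCochain n x α).compAt h i (monomialCochain m y β) =
      monomialCochain N (x * y) (fun z =>
        α (substAt h i z ((∏ k, blockAt h i z k) * y)) * β (blockAt h i z)) := by
  refine HochschildCochain.ext_single fun z => ?_
  rw [HochschildCochain.compAt_apply, monomialCochain_apply_single,
    ← comp_blockAt (fun g => MonoidAlgebra.single g (1 : K)), monomialCochain_apply_single,
    show MonoidAlgebra.single ((∏ k, blockAt h i z k) * y) (β (blockAt h i z)) =
      β (blockAt h i z) • MonoidAlgebra.single ((∏ k, blockAt h i z k) * y) (1 : K) by
        rw [MonoidAlgebra.smul_single, smul_eq_mul, mul_one],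
    substAt_eq_update h i _ (_ • _) (a' := 0), MultilinearMap.map_update_smul,
    ← substAt_eq_update, ← comp_substAt (fun g => MonoidAlgebra.single g (1 : K)),
    monomialCochain_apply_single, prod_substAt, MonoidAlgebra.smul_single, smul_eq_mul,
    mul_comm (β _), mul_assoc, mul_comm y]

end GroupAlgebra

/-! ### The differential and the bracket in coordinates -/

section GroupAlgebraBracket

variable {K G : Type u} [Field K] [CommGroup G] {n m N : ℕ}

/-- Contracting two neighbours preserves the total product, and multiplying a value by `x_0` on the
left or by `x_n` on the right supplies the missing factor of that product. For the right factor this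
uses commutativity. -/
theorem coeffCochain_hochschildDifferential (y : G)
    (f : HochschildCochain K (MonoidAlgebra K G) n) :
    coeffCochain (n + 1) y (hochschildDifferential K (MonoidAlgebra K G) n f) =
      groupDifferential K G n (coeffCochain n y f) := by
  funext x
  -- The group differential has one more contraction: the last one drops `x_n` and matches the
  -- Hochschild term with `x_n` on the right.
  rw [coeffCochain_apply, hochschildDifferential_apply, groupDifferential_apply,
    Fin.sum_univ_castSucc, contractNth_last, ← add_assoc]
  simp only [MonoidAlgebra.coeff_add, MonoidAlgebra.coeff_sum, MonoidAlgebra.coeff_smul,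
    Finsupp.add_apply, Finsupp.finsetSum_apply, Finsupp.smul_apply, smul_eq_mul,
    coeffCochain_apply, Fin.val_castSucc, Fin.val_last]
  congr 1
  · congr 1
    · rw [MonoidAlgebra.coeff_single_mul_apply, one_mul, Fin.prod_univ_succ]
      congr 1
      group
    · refine Finset.sum_congr rfl fun i _ => ?_
      have hp : ∏ j, Fin.contractNth i.castSucc (· * ·) x j = ∏ j, x j := by
        have := prod_substAt (by omega : n + 1 + 1 = n + 2) i x 1
        rw [mul_one, mul_one, Fin.prod_univ_two] at this
        rw [contractNth_castSucc_eq_substAt]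
        exact this
      rw [hp, contractNth_castSucc_eq_substAt, contractNth_castSucc_eq_substAt,
        comp_substAt (fun g => MonoidAlgebra.single g (1 : K)), MonoidAlgebra.single_mul_single,
        one_mul]
  · rw [MonoidAlgebra.coeff_mul_single_apply, mul_one, Fin.prod_univ_castSucc]
    congr 2
    rw [mul_right_comm, mul_inv_cancel_right]

variable [Finite G]

theorem hochschildDifferential_monomialCochain (y : G) (α : (Fin n → G) → K) :
    hochschildDifferential K (MonoidAlgebra K G) n (monomialCochain n y α) =
      monomialCochain (n + 1) y (groupDifferential K G n α) := by
  classical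
  refine HochschildCochain.ext_coeffCochain fun z => ?_
  rw [coeffCochain_hochschildDifferential, coeffCochain_monomialCochain,
    coeffCochain_monomialCochain]
  split_ifs
  · rfl
  · exact map_zero _

theorem monomialCochain_mem_cocycles {y : G} {α : (Fin n → G) → K} :
    monomialCochain n y α ∈ hochschildCocycles K (MonoidAlgebra K G) n ↔ IsGroupCocycle α := by
  rw [hochschildCocycles, LinearMap.mem_ker, hochschildDifferential_monomialCochain,
    map_eq_zero_iff _ (monomialCochain_injective y)]
  exact Iff.rfl

theorem comp_monomialCochain (h : N + 1 = n + m) (α : (Fin n → G) → K) (x : G)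
    (β : (Fin m → G) → K) (y : G) :
    (monomialCochain n x α).comp h (monomialCochain m y β) =
      monomialCochain N (x * y) (gammaSum h α β y) := by
  rw [HochschildCochain.comp, gammaSum, map_sum]
  refine Finset.sum_congr rfl fun i _ => ?_
  rw [compAt_monomialCochain, LinearMap.map_intUnits_smul, mul_comm (i : ℤ)]
  rfl

theorem bracket_monomialCochain (h : N + 1 = n + m) (α : (Fin n → G) → K) (x : G)
    (β : (Fin m → G) → K) (y : G) :
    (monomialCochain n x α).bracket h (monomialCochain m y β) =
      monomialCochain N (x * y) (bracketCoeff h α x β y) := by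
  -- The opposite composition lands in the component of `yx`, which is that of `xy` because `G` is
  -- abelian.
  rw [HochschildCochain.bracket, bracketCoeff, map_sub, LinearMap.map_intUnits_smul,
    comp_monomialCochain, comp_monomialCochain, mul_comm y x]

end GroupAlgebraBracket

/-! ### The isomorphism of Hochschild and group cohomology -/

section TensorMonoidAlgebra

variable {K G : Type*} [Field K]

/-- The coordinate at `y` of an element of `V ⊗ KG`. -/
noncomputable def tensorCoord (V : Type*) [AddCommGroup V] [Module K V] (y : G) :
    V ⊗[K] MonoidAlgebra K G →ₗ[K] V :=
  (TensorProduct.rid K V).toLinearMap.comp (((MonoidAlgebra.basis G K).coord y).lTensor V)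

theorem tensorCoord_tmul_single [DecidableEq G] {V : Type*} [AddCommGroup V] [Module K V]
    (y z : G) (v : V) :
    tensorCoord V y (v ⊗ₜ[K] MonoidAlgebra.single z (1 : K)) = if z = y then v else 0 := by
  simp only [tensorCoord, LinearMap.comp_apply, LinearMap.lTensor_tmul, LinearEquiv.coe_coe,
    TensorProduct.rid_tmul, Module.Basis.coord_apply, MonoidAlgebra.basis,
    MonoidAlgebra.coeffLinearEquiv_apply, MonoidAlgebra.coeff_single, Finsupp.single_apply]
  split_ifs <;> simp

/-- `V ⊗ KG` is spanned by the elements `v ⊗ x` with `x ∈ G`. -/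
theorem tensor_single_induction {V : Type*} [AddCommGroup V] [Module K V]
    {p : V ⊗[K] MonoidAlgebra K G → Prop} (t : V ⊗[K] MonoidAlgebra K G) (h0 : p 0)
    (h1 : ∀ v x, p (v ⊗ₜ MonoidAlgebra.single x (1 : K))) (hadd : ∀ s t, p s → p t → p (s + t)) :
    p t := by
  induction t using TensorProduct.induction_on with
  | zero => exact h0
  | add s t hs ht => exact hadd s t hs ht
  | tmul v a =>
    induction a using MonoidAlgebra.induction_linear with
    | zero => rwa [TensorProduct.tmul_zero]
    | add a b ha hb =>
      rw [TensorProduct.tmul_add]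
      exact hadd _ _ ha hb
    | single x c =>
      rw [show MonoidAlgebra.single x c = c • MonoidAlgebra.single x (1 : K) by
        rw [MonoidAlgebra.smul_single, smul_eq_mul, mul_one], ← TensorProduct.smul_tmul]
      exact h1 _ _

end TensorMonoidAlgebra

section CohomologyIso

variable (K G : Type u) [Field K] [CommGroup G] {n m N : ℕ}

/-- The coefficients of a Hochschild cocycle are group cocycles. -/
noncomputable def coeffCocycle (n : ℕ) (y : G) :
    hochschildCocycles K (MonoidAlgebra K G) n →ₗ[K] groupCocycles K G n :=
  ((coeffCochain n y).comp (hochschildCocycles K (MonoidAlgebra K G) n).subtype).codRestrict _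
    fun f => by
      rw [groupCocycles, LinearMap.mem_ker, LinearMap.comp_apply,
        ← coeffCochain_hochschildDifferential, Submodule.subtype_apply, LinearMap.mem_ker.1 f.2,
        map_zero]

variable {K G}

theorem coe_coeffCocycle (y : G) (f : hochschildCocycles K (MonoidAlgebra K G) n) :
    (coeffCocycle K G n y f : (Fin n → G) → K) = coeffCochain n y f.1 := rfl

/-- The differential respects the splitting over `y`, so a primitive exists exactly when every
coefficient has one. -/
theorem mem_hochschildCoboundaries_iff [Finite G]
    (f : hochschildCocycles K (MonoidAlgebra K G) n) :
    f.1 ∈ hochschildCoboundaries K (MonoidAlgebra K G) n ↔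
      ∀ y, groupClass K G n (coeffCocycle K G n y f) = 0 := by
  let := Fintype.ofFinite G
  obtain rfl | n := n
  · simp only [groupClass_zero_eq_zero_iff, Subtype.ext_iff, coe_coeffCocycle]
    refine ⟨fun h y => ?_, fun h => ?_⟩
    · obtain h : f.1 = 0 := h
      rw [h, map_zero]
      rfl
    · exact HochschildCochain.ext_coeffCochain fun y => (h y).trans (map_zero _).symm
  · simp only [groupClass_succ_eq_zero_iff, coe_coeffCocycle]
    refine ⟨?_, fun h => ?_⟩
    · rintro ⟨g, hg⟩ y
      exact ⟨coeffCochain n y g, by rw [← hg, coeffCochain_hochschildDifferential]⟩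
    · choose β hβ using h
      -- Primitives of the coefficients are reassembled into a primitive of `f`; the sum is finite
      -- because `G` is.
      refine ⟨∑ y, monomialCochain n y (β y), ?_⟩
      rw [map_sum, ← sum_monomialCochain f.1]
      exact Finset.sum_congr rfl fun y _ => by
        rw [hochschildDifferential_monomialCochain, hβ]

variable (K G) in
/-- The map `f ↦ ∑ y, [f_y] ⊗ y`, where `f_y` are the coefficients of the cocycle `f`. -/
noncomputable def toGroupCohomologyTensor [Finite G] (n : ℕ) :
    hochschildCocycles K (MonoidAlgebra K G) n →ₗ[K] GroupCohomologyTensor K G n :=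
  letI := Fintype.ofFinite G
  ∑ y : G, ((TensorProduct.mk K (groupCohomology (Rep.trivial K G K) n) (MonoidAlgebra K G)).flip
    (MonoidAlgebra.single y 1)).comp ((groupClass K G n).comp (coeffCocycle K G n y))

theorem toGroupCohomologyTensor_apply [Fintype G]
    (f : hochschildCocycles K (MonoidAlgebra K G) n) :
    toGroupCohomologyTensor K G n f =
      ∑ y : G, groupClass K G n (coeffCocycle K G n y f) ⊗ₜ[K] MonoidAlgebra.single y (1 : K) := by
  rw [toGroupCohomologyTensor, LinearMap.sum_apply]
  exact Finset.sum_congr (by ext; simp) fun _ _ => rfl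

/-- The elements `[α] ⊗ x` with `x ∈ G` span, and the specification fixes the bracket on them. -/
theorem IsTransferredBracket.unique {B B' : TotalGroupCohomologyTensor K G →ₗ[K]
      TotalGroupCohomologyTensor K G →ₗ[K] TotalGroupCohomologyTensor K G}
    (hB : IsTransferredBracket B) (hB' : IsTransferredBracket B') : B = B' := by
  refine DirectSum.bilinear_ext (P := TotalGroupCohomologyTensor K G) fun n m s t => ?_
  induction s using tensor_single_induction with
  | h0 => simp
  | hadd s s' hs hs' => simp only [map_add, LinearMap.add_apply, hs, hs']
  | h1 v x =>
    induction t using tensor_single_induction with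
    | h0 => simp
    | hadd t t' ht ht' => simp only [map_add, ht, ht']
    | h1 w y =>
      obtain ⟨α, rfl⟩ := groupClass_surjective v
      obtain ⟨β, rfl⟩ := groupClass_surjective w
      have hα := mem_groupCocycles.1 α.2
      have hβ := mem_groupCocycles.1 β.2
      change B (tensorClass α.1 hα x) (tensorClass β.1 hβ y) =
        B' (tensorClass α.1 hα x) (tensorClass β.1 hβ y)
      by_cases h : n + m = 0
      · obtain rfl : n = 0 := by omega
        obtain rfl : m = 0 := by omega
        rw [hB.zero_zero, hB'.zero_zero]
      · have h' : n + m - 1 + 1 = n + m := by omega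
        obtain ⟨_, e⟩ := hB.bracket_class h' α.1 β.1 hα hβ x y
        obtain ⟨_, e'⟩ := hB'.bracket_class h' α.1 β.1 hα hβ x y
        rw [e, e']

variable [Finite G]

theorem toGroupCohomologyTensor_monomialCochain (y : G) (α : (Fin n → G) → K)
    (hα : IsGroupCocycle α) :
    toGroupCohomologyTensor K G n ⟨monomialCochain n y α, monomialCochain_mem_cocycles.2 hα⟩ =
      groupClass K G n ⟨α, hα⟩ ⊗ₜ[K] MonoidAlgebra.single y (1 : K) := by
  classical
  let := Fintype.ofFinite G
  rw [toGroupCohomologyTensor_apply, Finset.sum_eq_single y]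
  · congr 2
    apply Subtype.ext
    rw [coe_coeffCocycle, coeffCochain_monomialCochain, if_pos rfl]
  · intro z _ hz
    rw [show coeffCocycle K G n z
      ⟨monomialCochain n y α, monomialCochain_mem_cocycles.2 hα⟩ = 0 from ?_, map_zero,
      TensorProduct.zero_tmul]
    apply Subtype.ext
    rw [coe_coeffCocycle, coeffCochain_monomialCochain, if_neg hz.symm]
    rfl
  · simp

theorem toGroupCohomologyTensor_surjective :
    Function.Surjective (toGroupCohomologyTensor K G n) := by
  intro t
  induction t using tensor_single_induction with
  | h0 => exact ⟨0, map_zero _⟩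
  | h1 v y =>
    obtain ⟨α, rfl⟩ := groupClass_surjective v
    exact ⟨_, toGroupCohomologyTensor_monomialCochain y α.1 α.2⟩
  | hadd s t hs ht =>
    obtain ⟨f, rfl⟩ := hs
    obtain ⟨g, rfl⟩ := ht
    exact ⟨f + g, map_add _ _ _⟩

theorem toGroupCohomologyTensor_eq_zero_iff (f : hochschildCocycles K (MonoidAlgebra K G) n) :
    toGroupCohomologyTensor K G n f = 0 ↔
      f.1 ∈ hochschildCoboundaries K (MonoidAlgebra K G) n := by
  classical
  let := Fintype.ofFinite G
  rw [mem_hochschildCoboundaries_iff, toGroupCohomologyTensor_apply]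
  refine ⟨fun h y => ?_, fun h => ?_⟩
  · have := congrArg (tensorCoord _ y) h
    simpa [map_sum, tensorCoord_tmul_single] using this
  · simp [h]

variable (K G) in
/-- The isomorphism `HH^n(KG) ≃ H^n(G, K) ⊗ KG`. -/
noncomputable def hochschildCohomologyEquiv (n : ℕ) :
    HochschildCohomology K (MonoidAlgebra K G) n ≃ₗ[K] GroupCohomologyTensor K G n :=
  (Submodule.quotEquivOfEq _ _ (by
    ext f
    exact (toGroupCohomologyTensor_eq_zero_iff f).symm)).trans
    ((toGroupCohomologyTensor K G n).quotKerEquivOfSurjective toGroupCohomologyTensor_surjective)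

variable (K G) in
/-- The isomorphism `HH^*(KG) ≃ H^*(G, K) ⊗ KG`. -/
noncomputable def totalHochschildCohomologyEquiv :
    TotalHochschildCohomology K (MonoidAlgebra K G) ≃ₗ[K] TotalGroupCohomologyTensor K G :=
  DFinsupp.mapRange.linearEquiv (hochschildCohomologyEquiv K G)

theorem totalHochschildCohomologyEquiv_apply (x : TotalHochschildCohomology K (MonoidAlgebra K G))
    (n : ℕ) :
    totalHochschildCohomologyEquiv K G x n = hochschildCohomologyEquiv K G n (x n) := rfl

theorem totalHochschildCohomologyEquiv_class (y : G) (α : (Fin n → G) → K)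
    (hα : IsGroupCocycle α) (hF : monomialCochain n y α ∈ hochschildCocycles K _ n) :
    totalHochschildCohomologyEquiv K G (hochschildClass (monomialCochain n y α) hF) =
      tensorClass α hα y := by
  refine (DFinsupp.mapRange_single (hf := fun _ => map_zero _)).trans ?_
  exact congrArg (DirectSum.of (GroupCohomologyTensor K G) n)
    (toGroupCohomologyTensor_monomialCochain y α hα)

theorem totalHochschildCohomologyEquiv_mem_iff (k : ℤ)
    (x : TotalHochschildCohomology K (MonoidAlgebra K G)) :
    totalHochschildCohomologyEquiv K G x ∈ shiftedGrading K (GroupCohomologyTensor K G) k ↔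
      x ∈ shiftedGrading K (HochschildCohomology K (MonoidAlgebra K G)) k := by
  refine forall_congr' fun n => imp_congr_right fun _ => ?_
  rw [totalHochschildCohomologyEquiv_apply]
  exact (hochschildCohomologyEquiv K G n).map_eq_zero_iff

/-- The transport of a bracket on `HH^*(KG)` to `H^*(G, K) ⊗ KG`. -/
noncomputable def transferBracket (B' : TotalHochschildCohomology K (MonoidAlgebra K G) →ₗ[K]
      TotalHochschildCohomology K (MonoidAlgebra K G) →ₗ[K]
      TotalHochschildCohomology K (MonoidAlgebra K G)) :
    TotalGroupCohomologyTensor K G →ₗ[K] TotalGroupCohomologyTensor K G →ₗ[K]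
      TotalGroupCohomologyTensor K G :=
  LinearMap.mk₂ K (fun s t => totalHochschildCohomologyEquiv K G
      (B' ((totalHochschildCohomologyEquiv K G).symm s)
        ((totalHochschildCohomologyEquiv K G).symm t)))
    (fun s s' t => by rw [map_add, map_add, LinearMap.add_apply, map_add])
    (fun c s t => by rw [map_smul, map_smul, LinearMap.smul_apply, map_smul])
    (fun s t t' => by rw [map_add, map_add, map_add])
    (fun c s t => by rw [map_smul, map_smul, map_smul])

variable {B' : TotalHochschildCohomology K (MonoidAlgebra K G) →ₗ[K]
      TotalHochschildCohomology K (MonoidAlgebra K G) →ₗ[K]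
      TotalHochschildCohomology K (MonoidAlgebra K G)}

theorem transferBracket_apply (x y : TotalHochschildCohomology K (MonoidAlgebra K G)) :
    transferBracket B' (totalHochschildCohomologyEquiv K G x)
      (totalHochschildCohomologyEquiv K G y) = totalHochschildCohomologyEquiv K G (B' x y) := by
  rw [transferBracket, LinearMap.mk₂_apply, LinearEquiv.symm_apply_apply,
    LinearEquiv.symm_apply_apply]

/-- A function is a group cocycle exactly when its monomial cochain is a Hochschild cocycle, so the
cocycle claim for `bracketCoeff` is read off from the Hochschild side. -/
theorem IsGerstenhaberBracket.isTransferredBracket (hB : IsGerstenhaberBracket B') :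
    IsTransferredBracket (transferBracket B') := by
  refine ⟨fun α β hα hβ x y => ?_, fun {n m N} h α β hα hβ x y => ?_⟩
  · rw [← totalHochschildCohomologyEquiv_class x α hα (monomialCochain_mem_cocycles.2 hα),
      ← totalHochschildCohomologyEquiv_class y β hβ (monomialCochain_mem_cocycles.2 hβ),
      transferBracket_apply, hB.zero_zero, map_zero]
  · obtain ⟨hfg, e⟩ := hB.bracket_class h (monomialCochain n x α) (monomialCochain m y β)
      (monomialCochain_mem_cocycles.2 hα) (monomialCochain_mem_cocycles.2 hβ)
    simp only [bracket_monomialCochain] at hfg e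
    refine ⟨monomialCochain_mem_cocycles.1 hfg, ?_⟩
    rw [← totalHochschildCohomologyEquiv_class x α hα (monomialCochain_mem_cocycles.2 hα),
      ← totalHochschildCohomologyEquiv_class y β hβ (monomialCochain_mem_cocycles.2 hβ),
      transferBracket_apply, e, totalHochschildCohomologyEquiv_class]

end CohomologyIso

theorem mainTheorem3 (K G : Type u) [Field K] [CommGroup G] [Finite G] :
    (∃! B, IsTransferredBracket (K := K) (G := G) B) ∧
    (∃! B', IsGerstenhaberBracket (K := K) (A := MonoidAlgebra K G) B') ∧
    ∀ B B', IsTransferredBracket (K := K) (G := G) B →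
      IsGerstenhaberBracket (K := K) (A := MonoidAlgebra K G) B' →
      IsGradedLieAlgebra (shiftedGrading K (GroupCohomologyTensor K G)) B ∧
      IsGradedLieAlgebra (shiftedGrading K (HochschildCohomology K (MonoidAlgebra K G))) B' ∧
      ∃ e : TotalHochschildCohomology K (MonoidAlgebra K G) ≃ₗ[K] TotalGroupCohomologyTensor K G,
        IsGradedLieIso (shiftedGrading K (HochschildCohomology K (MonoidAlgebra K G))) B'
          (shiftedGrading K (GroupCohomologyTensor K G)) B e := by
  obtain ⟨C, hC⟩ := exists_isGerstenhaberBracket K (MonoidAlgebra K G)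
  refine ⟨⟨_, hC.isTransferredBracket, fun B hB => hB.unique hC.isTransferredBracket⟩,
    ⟨C, hC, fun B hB => hB.unique hC⟩, fun B B' hB hB' => ?_⟩
  -- By uniqueness `B` is the transport of `B'`, so compatibility of the isomorphism with the
  -- brackets holds by construction.
  obtain rfl := hB.unique hB'.isTransferredBracket
  refine ⟨?_, hB'.isGradedLieAlgebra, totalHochschildCohomologyEquiv K G,
    totalHochschildCohomologyEquiv_mem_iff, fun x y => (transferBracket_apply x y).symm⟩
  refine hB'.isGradedLieAlgebra.of_surjective isInternal_shiftedGrading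
    (totalHochschildCohomologyEquiv K G).toLinearMap
    (fun k x hx => (totalHochschildCohomologyEquiv_mem_iff k x).2 hx) (fun k y hy => ?_)
    transferBracket_apply
  obtain ⟨x, rfl⟩ := (totalHochschildCohomologyEquiv K G).surjective y
  exact ⟨x, (totalHochschildCohomologyEquiv_mem_iff k x).1 hy, rfl⟩
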